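/- For positive integers $n,k$, say that $(n,k)$ has a prime representation if there are distinct primes $P_1,\dots,P_k$ with $P_j\mid n+j$ for $1\le j\le k$. Let $g(n)$ be the largest positive integer $k$ such that $(n,k)$ has a prime representation. Let $\omega(m)$ be the number of distinct prime divisors of $m$, and let $g_1(n)$ be the largest positive integer $k$ such that $\omega\left(\prod_{i=1}^{l}(n+i)\right)\ge l$ for all $1\le l\le k$. Theorem. There exists a $\gamma$ with $0<\gamma<\frac12$ such that $$g(n)\le g_1(n)<n^{\gamma}$$ for all sufficiently large $n$. Moreover, $\gamma=\frac12-\frac1{390}$ is permissible. In particular, there is a constant $c>0$ such that $g(n)<n^{\frac12-c}$ for all sufficiently large $n$. -/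

import Mathlib

open Filter

namespace Grimm

/-- `(n, k)` has a prime representation: there are pairwise distinct primes `P 1, …, P k` with
`P j ∣ n + j` for `1 ≤ j ≤ k`. -/
def HasPrimeRepresentation (n k : ℕ) : Prop :=
  ∃ P : ℕ → ℕ, Set.InjOn P (Set.Icc 1 k) ∧
    ∀ j ∈ Set.Icc 1 k, (P j).Prime ∧ P j ∣ n + j

/-- The positive integers `k` such that `(n, k)` has a prime representation. -/
def gSet (n : ℕ) : Set ℕ := {k | 1 ≤ k ∧ HasPrimeRepresentation n k}

/-- The positive integers `k` such that `ω((n + 1) ⋯ (n + l)) ≥ l` for all `1 ≤ l ≤ k`, where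
`ω` counts distinct prime divisors. -/
def g₁Set (n : ℕ) : Set ℕ :=
  {k | 1 ≤ k ∧ ∀ l, 1 ≤ l → l ≤ k →
    l ≤ ArithmeticFunction.cardDistinctFactors (∏ i ∈ Finset.Icc 1 l, (n + i))}

/-- The largest positive integer `k` such that `(n, k)` has a prime representation
(for `n ≥ 1` this maximum exists, see `isGreatest_g`). -/
noncomputable def g (n : ℕ) : ℕ := sSup (gSet n)

/-- The largest positive integer `k` such that `ω((n + 1) ⋯ (n + l)) ≥ l` for all `1 ≤ l ≤ k`
(for `n ≥ 1` this maximum exists, see `isGreatest_g₁`). -/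
noncomputable def g₁ (n : ℕ) : ℕ := sSup (g₁Set n)

theorem prod_ne_zero (n l : ℕ) : ∏ i ∈ Finset.Icc 1 l, (n + i) ≠ 0 := by
  refine Finset.prod_ne_zero_iff.2 fun i hi => ?_
  have := (Finset.mem_Icc.1 hi).1
  omega

theorem gSet_subset_g₁Set (n : ℕ) : gSet n ⊆ g₁Set n := by
  rintro k ⟨hk, P, hinj, hP⟩
  refine ⟨hk, fun l _ hlk => ?_⟩
  have hsub : (Finset.Icc 1 l).image P ⊆ (∏ i ∈ Finset.Icc 1 l, (n + i)).primeFactors := by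
    intro p hp
    obtain ⟨j, hj, rfl⟩ := Finset.mem_image.1 hp
    have hj' := Finset.mem_Icc.1 hj
    obtain ⟨h1, h2⟩ := hP j ⟨hj'.1, hj'.2.trans hlk⟩
    exact Nat.mem_primeFactors.2 ⟨h1, h2.trans (Finset.dvd_prod_of_mem _ hj), prod_ne_zero n l⟩
  have hcard : ((Finset.Icc 1 l).image P).card = l := by
    rw [Finset.card_image_of_injOn, Nat.card_Icc, Nat.add_sub_cancel]
    rw [Finset.coe_Icc]
    exact hinj.mono (Set.Icc_subset_Icc_right hlk)
  have := Finset.card_le_card hsub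
  rwa [hcard] at this

theorem le_of_mem_g₁Set {n k : ℕ} (hk : k ∈ g₁Set n) : k ≤ n + 1 := by
  by_contra! hlt
  have h := hk.2 (n + 2) (by omega) hlt
  have hsub : (∏ i ∈ Finset.Icc 1 (n + 2), (n + i)).primeFactors ⊆
      (Finset.range (n + 1)).image (fun a => if a = 0 then 2 else 2 * a + 1) := by
    intro p hp
    obtain ⟨hp1, hp2, -⟩ := Nat.mem_primeFactors.1 hp
    obtain ⟨i, hi, hd⟩ := (hp1.prime.dvd_finsetProd_iff _).1 hp2
    have hi' := Finset.mem_Icc.1 hi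
    have hle := Nat.le_of_dvd (by omega) hd
    rcases hp1.eq_two_or_odd with rfl | hodd
    · exact Finset.mem_image.2 ⟨0, by simp, by simp⟩
    · have := hp1.two_le
      refine Finset.mem_image.2 ⟨p / 2, Finset.mem_range.2 (by omega), ?_⟩
      rw [if_neg (by omega)]
      omega
  have h2 := (Finset.card_le_card hsub).trans Finset.card_image_le
  rw [Finset.card_range] at h2
  have h3 : n + 2 ≤ (∏ i ∈ Finset.Icc 1 (n + 2), (n + i)).primeFactors.card := h
  omega

theorem one_mem_gSet {n : ℕ} (hn : 1 ≤ n) : 1 ∈ gSet n := by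
  refine ⟨le_rfl, fun _ => (n + 1).minFac, ?_, ?_⟩
  · intro a ha b hb _
    exact (le_antisymm ha.2 ha.1).trans (le_antisymm hb.2 hb.1).symm
  · intro j hj
    obtain rfl : j = 1 := le_antisymm hj.2 hj.1
    exact ⟨Nat.minFac_prime (by omega), Nat.minFac_dvd _⟩

theorem isGreatest_g₁ {n : ℕ} (hn : 1 ≤ n) : IsGreatest (g₁Set n) (g₁ n) := by
  have hb : BddAbove (g₁Set n) := ⟨n + 1, fun _ hk => le_of_mem_g₁Set hk⟩
  exact ⟨Nat.sSup_mem ⟨1, gSet_subset_g₁Set n (one_mem_gSet hn)⟩ hb, fun _ hk => le_csSup hb hk⟩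

theorem isGreatest_g {n : ℕ} (hn : 1 ≤ n) : IsGreatest (gSet n) (g n) := by
  have hb : BddAbove (gSet n) := ⟨n + 1, fun _ hk => le_of_mem_g₁Set (gSet_subset_g₁Set n hk)⟩
  exact ⟨Nat.sSup_mem ⟨1, one_mem_gSet hn⟩ hb, fun _ hk => le_csSup hb hk⟩

end Grimm

/-!
Write `γ = 1/2 - 1/390 = 97/195`, and suppose that `l = ⌈n ^ γ⌉` satisfies `l ≤ g₁ n`, so that
`(n + 1) ⋯ (n + l)` has at least `l` distinct prime factors. Only `o(l)` of them are at most `l`;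
the others divide the binomial coefficient `C(n + l, l)`, whose logarithm is at most
`l (log (n / l) + O(1))`. Hence these nearly `l` primes `p > l` satisfy
`∑ log (p / l) ≤ l ((1 - 2γ) log n + o(log n))` with `1 - 2γ = 1/195`: on average they barely exceed
`l` (`log_count_le_of_le_card_primeFactors`).

On the other hand at most `3/5 * l` primes in `(l, l n ^ (1/64)]` divide one of `n + 1, …, n + l`
(`eventually_card_prime_dvd_le`), so nearly `2/5 * l` primes have `log (p / l) ≥ (log n) / 64`.
Since `2/5 * 1/64 > 1/195`, this is a contradiction for large `n`.

The count of primes in a dyadic interval `(M, 2M]` with `M = l H` goes as follows. If `p > M`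
divides some `n + i` with `1 ≤ i ≤ l`, then `(n + l/2) / p` is within `1 / (2H)` of an integer, so `p`
is counted with weight at least `1` by a multiple of the Fejér kernel of length `H` evaluated at
`(n + l/2) / p`. The weights of the multiples of `d` are evaluated through the exponential sums
`∑ e (y / m)`, which are bounded by van der Corput differencing and the Kusmin–Landau inequality
(`norm_sum_e_div_sq_le`). This equidistribution, for `d` up to `n ^ (1/5)`, feeds the Selberg sieve
(`sum_prime_le_of_equidistributed`), which saves the factor `log n` that is needed.
-/

namespace Grimm

/-! ### Exponential sums -/

/-- The additive character `t ↦ exp (2πit)` on the reals, as a complex number. -/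
noncomputable def e (t : ℝ) : ℂ := Complex.exp (Complex.I * ((2 * Real.pi * t : ℝ) : ℂ))

theorem norm_e (t : ℝ) : ‖e t‖ = 1 := by
  rw [e, mul_comm]; exact Complex.norm_exp_ofReal_mul_I _

theorem e_add (s t : ℝ) : e (s + t) = e s * e t := by
  rw [e, e, e, ← Complex.exp_add]; congr 1; push_cast; ring

theorem conj_e (t : ℝ) : (starRingEnd ℂ) (e t) = e (-t) := by
  rw [e, e, ← Complex.exp_conj]; congr 1
  simp only [map_mul, Complex.conj_I, Complex.conj_ofReal]; push_cast; ring

theorem e_mul_conj_e (s t : ℝ) : e s * (starRingEnd ℂ) (e t) = e (s - t) := by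
  rw [conj_e, ← e_add, sub_eq_add_neg]

theorem e_eq_cos_add_sin (t : ℝ) :
    e t = (Real.cos (2 * Real.pi * t) : ℂ) + (Real.sin (2 * Real.pi * t) : ℂ) * Complex.I := by
  rw [e, mul_comm, Complex.exp_mul_I]; push_cast; rfl

theorem e_intCast (q : ℤ) : e q = 1 := by
  rw [e]
  have := Complex.exp_int_mul_two_pi_mul_I q
  rw [← this]; congr 1; push_cast; ring

theorem norm_e_sub_one (t : ℝ) : ‖e t - 1‖ = 2 * |Real.sin (Real.pi * t)| := by
  rw [e, Complex.norm_exp_I_mul_ofReal_sub_one, norm_mul, Real.norm_eq_abs, Real.norm_eq_abs]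
  norm_num
  congr 2; ring

theorem e_natCast_mul (h : ℕ) (t : ℝ) : e (h * t) = e t ^ h := by
  rw [e, e, ← Complex.exp_nat_mul]; congr 1; push_cast; ring

theorem two_mul_le_sin_pi_mul {x : ℝ} (h0 : 0 ≤ x) (h1 : x ≤ 1 / 2) :
    2 * x ≤ Real.sin (Real.pi * x) := by
  have := Real.mul_le_sin (x := Real.pi * x) (by positivity) (by nlinarith [Real.pi_pos])
  have hp := Real.pi_pos
  calc 2 * x = 2 / Real.pi * (Real.pi * x) := by field_simp
    _ ≤ _ := this

/-- The factor `1 / (1 - e δ)` that inverts the difference operator on a geometric progression. -/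
noncomputable def kusminLandauWeight (δ : ℝ) : ℂ :=
  (1 + (Real.cot (Real.pi * δ) : ℂ) * Complex.I) / 2

theorem one_sub_e_mul_kusminLandauWeight {δ : ℝ} (h : Real.sin (Real.pi * δ) ≠ 0) :
    (1 - e δ) * kusminLandauWeight δ = 1 := by
  rw [e_eq_cos_add_sin, kusminLandauWeight, Real.cot_eq_cos_div_sin,
    show 2 * Real.pi * δ = 2 * (Real.pi * δ) by ring, Real.cos_two_mul, Real.sin_two_mul]
  set s := Real.sin (Real.pi * δ)
  set c := Real.cos (Real.pi * δ)
  have hs : (s : ℂ) ≠ 0 := by exact_mod_cast h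
  have hsc : (s : ℂ) ^ 2 = 1 - (c : ℂ) ^ 2 := by
    have : s ^ 2 = 1 - c ^ 2 := by rw [Real.sin_sq]
    exact_mod_cast this
  push_cast
  field_simp
  ring_nf
  have hI : Complex.I ^ 2 = -1 := Complex.I_sq
  simp only [hI]
  linear_combination (-2 * c * Complex.I) * hsc

theorem norm_kusminLandauWeight_le {δ θ : ℝ} (hθ : 0 < θ) (h0 : θ ≤ δ) (h1 : δ ≤ 1 / 2) :
    ‖kusminLandauWeight δ‖ ≤ 1 / (4 * θ) := by
  have hs := two_mul_le_sin_pi_mul (hθ.le.trans h0) h1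
  have hs0 : 0 < Real.sin (Real.pi * δ) := by linarith
  have h := one_sub_e_mul_kusminLandauWeight hs0.ne'
  have h2 : ‖1 - e δ‖ * ‖kusminLandauWeight δ‖ = 1 := by rw [← norm_mul, h, norm_one]
  rw [norm_sub_rev, norm_e_sub_one, abs_of_pos hs0] at h2
  rw [le_div_iff₀ (by positivity)]
  nlinarith [norm_nonneg (kusminLandauWeight δ)]

theorem cot_le {δ θ : ℝ} (hθ : 0 < θ) (h0 : θ ≤ δ) (h1 : δ ≤ 1 / 2) :
    Real.cot (Real.pi * δ) ≤ 1 / (2 * θ) := by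
  have hs := two_mul_le_sin_pi_mul (hθ.le.trans h0) h1
  rw [Real.cot_eq_cos_div_sin]
  calc _ ≤ 1 / Real.sin (Real.pi * δ) := by
        gcongr
        · linarith
        · exact Real.cos_le_one _
    _ ≤ 1 / (2 * θ) := by gcongr; linarith

theorem cot_nonneg {δ : ℝ} (h0 : 0 < δ) (h1 : δ ≤ 1 / 2) : 0 ≤ Real.cot (Real.pi * δ) := by
  have hs := two_mul_le_sin_pi_mul h0.le h1
  rw [Real.cot_eq_cos_div_sin]
  refine div_nonneg (Real.cos_nonneg_of_mem_Icc ⟨?_, ?_⟩) (by linarith) <;>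
    nlinarith [Real.pi_pos]

theorem cot_anti {δ δ' : ℝ} (h0 : 0 < δ) (h : δ ≤ δ') (h1 : δ' ≤ 1 / 2) :
    Real.cot (Real.pi * δ') ≤ Real.cot (Real.pi * δ) := by
  have hs := two_mul_le_sin_pi_mul h0.le (h.trans h1)
  have hs' := two_mul_le_sin_pi_mul (h0.le.trans h) h1
  rw [Real.cot_eq_cos_div_sin, Real.cot_eq_cos_div_sin]
  have hp := Real.pi_pos
  have hc : Real.cos (Real.pi * δ') ≤ Real.cos (Real.pi * δ) :=
    Real.cos_le_cos_of_nonneg_of_le_pi (by positivity) (by nlinarith) (by gcongr)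
  have hsin : Real.sin (Real.pi * δ) ≤ Real.sin (Real.pi * δ') :=
    Real.sin_le_sin_of_le_of_le_pi_div_two (by nlinarith) (by nlinarith) (by gcongr)
  have hc0 : 0 ≤ Real.cos (Real.pi * δ) :=
    Real.cos_nonneg_of_mem_Icc ⟨by nlinarith, by nlinarith⟩
  gcongr
  linarith

/-- The Kusmin–Landau inequality: if the increments of the phase are nonincreasing and lie in
`[θ, 1/2]`, the exponential sum is at most `1 / θ`. It is summation by parts against
`kusminLandauWeight`. -/
theorem norm_sum_e_le_of_antitone_increments (f : ℕ → ℝ) (N : ℕ) {θ : ℝ} (hθ : 0 < θ)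
    (hlow : ∀ j ≤ N, θ ≤ f (j + 1) - f j) (hup : ∀ j ≤ N, f (j + 1) - f j ≤ 1 / 2)
    (hanti : ∀ j < N, f (j + 2) - f (j + 1) ≤ f (j + 1) - f j) :
    ‖∑ j ∈ Finset.range N, e (f j)‖ ≤ 1 / θ := by
  set δ : ℕ → ℝ := fun j => f (j + 1) - f j with hδ
  have key : ∀ K ≤ N, ‖∑ j ∈ Finset.range K, e (f j) + e (f K) * kusminLandauWeight (δ K) -
      e (f 0) * kusminLandauWeight (δ 0)‖ ≤
      (Real.cot (Real.pi * δ K) - Real.cot (Real.pi * δ 0)) / 2 := by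
    intro K
    induction K with
    | zero => intro _; simp
    | succ K ih =>
      intro hK
      have hK' : K ≤ N := by omega
      have hsin : Real.sin (Real.pi * δ K) ≠ 0 := by
        have := two_mul_le_sin_pi_mul (hθ.le.trans (hlow K hK')) (hup K hK')
        have h2 := hlow K hK'
        have : 0 < Real.sin (Real.pi * δ K) := by simp only [hδ]; linarith
        exact this.ne'
      have hw := one_sub_e_mul_kusminLandauWeight hsin
      have he : e (f (K + 1)) = e (f K) * e (δ K) := by rw [← e_add]; congr 1; simp [hδ]
      have hdiff : kusminLandauWeight (δ (K + 1)) - kusminLandauWeight (δ K) =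
          (((Real.cot (Real.pi * δ (K + 1)) - Real.cot (Real.pi * δ K)) / 2 : ℝ) : ℂ) *
            Complex.I := by
        simp only [kusminLandauWeight]; push_cast; ring
      have hnorm : ‖e (f (K + 1)) * (kusminLandauWeight (δ (K + 1)) - kusminLandauWeight (δ K))‖ =
          (Real.cot (Real.pi * δ (K + 1)) - Real.cot (Real.pi * δ K)) / 2 := by
        rw [norm_mul, norm_e, one_mul, hdiff, norm_mul, Complex.norm_I, mul_one,
          Complex.norm_real, Real.norm_eq_abs, abs_of_nonneg]
        have := cot_anti (hθ.trans_le (hlow (K + 1) hK)) (hanti K (by omega)) (hup K hK')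
        simp only [hδ]; linarith
      have heq : ∑ j ∈ Finset.range (K + 1), e (f j) +
          e (f (K + 1)) * kusminLandauWeight (δ (K + 1)) -
          e (f 0) * kusminLandauWeight (δ 0) =
          (∑ j ∈ Finset.range K, e (f j) + e (f K) * kusminLandauWeight (δ K) -
            e (f 0) * kusminLandauWeight (δ 0)) +
          e (f (K + 1)) * (kusminLandauWeight (δ (K + 1)) - kusminLandauWeight (δ K)) := by
        rw [Finset.sum_range_succ, he]
        linear_combination -(e (f K)) * hw
      rw [heq]
      refine (norm_add_le _ _).trans ?_
      rw [hnorm]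
      linarith [ih hK']
  have h := key N le_rfl
  have h1 := norm_kusminLandauWeight_le hθ (hlow N le_rfl) (hup N le_rfl)
  have h2 := norm_kusminLandauWeight_le hθ (hlow 0 (Nat.zero_le _)) (hup 0 (Nat.zero_le _))
  have h3 := cot_le hθ (hlow N le_rfl) (hup N le_rfl)
  have h4 := cot_nonneg (hθ.trans_le (hlow 0 (Nat.zero_le _))) (hup 0 (Nat.zero_le _))
  have hsum : ∑ j ∈ Finset.range N, e (f j) =
      (∑ j ∈ Finset.range N, e (f j) + e (f N) * kusminLandauWeight (δ N) -
        e (f 0) * kusminLandauWeight (δ 0)) -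
        e (f N) * kusminLandauWeight (δ N) + e (f 0) * kusminLandauWeight (δ 0) := by ring
  rw [hsum]
  refine (norm_add_le _ _).trans ((add_le_add_left (norm_sub_le _ _) _).trans ?_)
  rw [norm_mul, norm_mul, norm_e, norm_e, one_mul, one_mul]
  have e1 : 1 / (2 * θ) = (1 / θ) / 2 := by field_simp
  have e2 : 1 / (4 * θ) = (1 / θ) / 4 := by field_simp
  rw [e1] at h3; rw [e2] at h1 h2
  have h5 : 0 < 1 / θ := by positivity
  linarith

/-- Opening the square of a sum of `H` functions and separating the diagonal. -/
theorem abs_sum_norm_sq_sub_diag_le {ι : Type*} (s : Finset ι) (H : ℕ) (z : ℕ → ι → ℂ) :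
    |∑ t ∈ s, ‖∑ h ∈ Finset.range H, z h t‖ ^ 2 -
        ∑ h ∈ Finset.range H, ∑ t ∈ s, ‖z h t‖ ^ 2| ≤
      2 * ∑ h ∈ Finset.range H, ∑ h' ∈ Finset.range h,
        ‖∑ t ∈ s, z h t * (starRingEnd ℂ) (z h' t)‖ := by
  induction H with
  | zero => simp
  | succ H ih =>
    have hsq : ∀ t, ‖∑ h ∈ Finset.range (H + 1), z h t‖ ^ 2 =
        ‖∑ h ∈ Finset.range H, z h t‖ ^ 2 + ‖z H t‖ ^ 2 +
          2 * (∑ h' ∈ Finset.range H, z H t * (starRingEnd ℂ) (z h' t)).re := by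
      intro t
      rw [Finset.sum_range_succ, add_comm, ← Complex.normSq_eq_norm_sq,
        ← Complex.normSq_eq_norm_sq, ← Complex.normSq_eq_norm_sq, Complex.normSq_add,
          map_sum (starRingEnd ℂ),
        Finset.mul_sum]
      ring
    simp_rw [hsq]
    rw [Finset.sum_add_distrib, Finset.sum_add_distrib, Finset.sum_range_succ,
      Finset.sum_range_succ (fun h => ∑ h' ∈ Finset.range h, _), ← Finset.mul_sum,
      ← Complex.re_sum, Finset.sum_comm (s := s)]
    have hre : |(∑ h' ∈ Finset.range H, ∑ t ∈ s, z H t * (starRingEnd ℂ) (z h' t)).re| ≤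
        ∑ h' ∈ Finset.range H, ‖∑ t ∈ s, z H t * (starRingEnd ℂ) (z h' t)‖ :=
      (Complex.abs_re_le_norm _).trans (norm_sum_le _ _)
    rw [abs_le] at ih hre ⊢
    constructor <;> linarith [ih.1, ih.2, hre.1, hre.2]

/-- The inequality of van der Corput and Weyl: a bound for the sums of the differenced sequences
gives a bound for the sum of the sequence. -/
theorem norm_sum_sq_le_of_differenced (z : ℕ → ℂ) (hz : ∀ j, ‖z j‖ = 1) {N L : ℕ} (hL : 1 ≤ L)
    (hLN : L ≤ N) (B : ℕ → ℝ) (hB0 : ∀ a, 0 ≤ B a)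
    (hB : ∀ a, 1 ≤ a → a < L →
      ‖∑ j ∈ Finset.range (N - a), z (j + a) * (starRingEnd ℂ) (z j)‖ ≤ B a) :
    ‖∑ j ∈ Finset.range N, z j‖ ^ 2 ≤
      2 * N / L * (N + 2 * ∑ a ∈ Finset.Ico 1 L, B a) := by
  set u : ℕ → ℂ := fun k => if L ≤ k ∧ k < L + N then z (k - L) else 0 with hu
  -- Zero padding replaces the integers as index set: every shift by `l ≤ L` keeps the
  -- support of `u` inside the range of summation.
  have hshift : ∀ (v : ℕ → ℂ) (K l : ℕ), l ≤ L → K ≤ N →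
      (∀ k, k < L ∨ L + K ≤ k → v k = 0) →
      ∑ n ∈ Finset.range (N + L), v (n + l) = ∑ j ∈ Finset.range K, v (j + L) := by
    intro v K l hl hK hv
    have h1 : ∑ j ∈ Finset.range K, v (j + L) = ∑ n ∈ (Finset.range K).image (· + (L - l)),
        v (n + l) := by
      rw [Finset.sum_image (by intro a _ b _ h; simpa using h)]
      refine Finset.sum_congr rfl fun j _ => ?_
      congr 1; omega
    rw [h1]
    symm
    refine Finset.sum_subset ?_ ?_
    · intro n hn
      simp only [Finset.mem_image, Finset.mem_range] at hn ⊢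
      obtain ⟨a, ha, rfl⟩ := hn
      omega
    · intro n hn hn'
      apply hv
      by_contra hcon
      push Not at hcon
      apply hn'
      simp only [Finset.mem_image, Finset.mem_range]
      exact ⟨n + l - L, by omega, by omega⟩
  have hS : ∀ l, l ≤ L → ∑ n ∈ Finset.range (N + L), u (n + l) = ∑ j ∈ Finset.range N, z j := by
    intro l hl
    rw [hshift u N l hl le_rfl (by intro k hk; simp only [hu]; rw [if_neg (by omega)])]
    refine Finset.sum_congr rfl fun j hj => ?_
    simp only [hu, Finset.mem_range] at hj ⊢
    rw [if_pos (by omega), Nat.add_sub_cancel]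
  have hSq : ∀ l, l ≤ L → ∑ n ∈ Finset.range (N + L), ‖u (n + l)‖ ^ 2 = N := by
    intro l hl
    have := hshift (fun k => ((‖u k‖ ^ 2 : ℝ) : ℂ)) N l hl le_rfl
      (by intro k hk; simp only [hu]; rw [if_neg (by omega)]; simp)
    rw [← Complex.ofReal_sum, ← Complex.ofReal_sum] at this
    rw [Complex.ofReal_injective this]
    rw [Finset.sum_congr rfl (g := fun _ => (1 : ℝ))]
    · simp
    · intro j hj
      simp only [hu, Finset.mem_range] at hj ⊢
      rw [if_pos (by omega), hz]; norm_num
  have hcross : ∀ l' a, l' + a < L → 1 ≤ a →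
      ‖∑ n ∈ Finset.range (N + L), u (n + (l' + a)) * (starRingEnd ℂ) (u (n + l'))‖ ≤ B a := by
    intro l' a hla ha
    have := hshift (fun k => u (k + a) * (starRingEnd ℂ) (u k)) (N - a) l' (by omega) (by omega)
      (by
        intro k hk
        rcases hk with hk | hk
        · have : u k = 0 := by simp only [hu]; rw [if_neg (by omega)]
          simp [this]
        · have : u (k + a) = 0 := by simp only [hu]; rw [if_neg (by omega)]
          simp [this])
    simp only [add_assoc] at this
    rw [this]
    refine le_trans (le_of_eq ?_) (hB a ha (by omega))
    congr 1
    refine Finset.sum_congr rfl fun j hj => ?_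
    simp only [hu, Finset.mem_range] at hj ⊢
    rw [if_pos (by omega), if_pos (by omega), Nat.add_sub_cancel,
      show j + (L + a) - L = j + a by omega]
  have hL0 : (0 : ℝ) < L := by exact_mod_cast hL
  have hmain : (L : ℝ) ^ 2 * ‖∑ j ∈ Finset.range N, z j‖ ^ 2 ≤
      (N + L) * (L * N + 2 * (L * ∑ a ∈ Finset.Ico 1 L, B a)) := by
    have h1 : (L : ℂ) * ∑ j ∈ Finset.range N, z j =
        ∑ n ∈ Finset.range (N + L), ∑ l ∈ Finset.range L, u (n + l) := by
      rw [Finset.sum_comm, Finset.sum_congr rfl fun l hl => hS l (Finset.mem_range.1 hl).le]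
      simp
    have h2 : (L : ℝ) ^ 2 * ‖∑ j ∈ Finset.range N, z j‖ ^ 2 =
        ‖∑ n ∈ Finset.range (N + L), ∑ l ∈ Finset.range L, u (n + l)‖ ^ 2 := by
      rw [← h1, norm_mul, Complex.norm_natCast, mul_pow]
    rw [h2]
    have h3 : ‖∑ n ∈ Finset.range (N + L), ∑ l ∈ Finset.range L, u (n + l)‖ ^ 2 ≤
        (N + L) * ∑ n ∈ Finset.range (N + L), ‖∑ l ∈ Finset.range L, u (n + l)‖ ^ 2 := by
      refine (pow_le_pow_left₀ (norm_nonneg _) (norm_sum_le _ _) 2).trans ?_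
      have := sq_sum_le_card_mul_sum_sq (s := Finset.range (N + L))
        (f := fun n => ‖∑ l ∈ Finset.range L, u (n + l)‖)
      simpa using this
    refine h3.trans ?_
    gcongr
    have h4 := (abs_le.1 (abs_sum_norm_sq_sub_diag_le (Finset.range (N + L)) L
      (fun l n => u (n + l)))).2
    have h5 : ∑ l ∈ Finset.range L, ∑ n ∈ Finset.range (N + L), ‖u (n + l)‖ ^ 2 = L * N := by
      rw [Finset.sum_congr rfl fun l hl => hSq l (Finset.mem_range.1 hl).le]; simp
    have h6 : ∑ l ∈ Finset.range L, ∑ l' ∈ Finset.range l,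
        ‖∑ n ∈ Finset.range (N + L), u (n + l) * (starRingEnd ℂ) (u (n + l'))‖ ≤
        L * ∑ a ∈ Finset.Ico 1 L, B a := by
      have : ∀ l ∈ Finset.range L, ∑ l' ∈ Finset.range l,
          ‖∑ n ∈ Finset.range (N + L), u (n + l) * (starRingEnd ℂ) (u (n + l'))‖ ≤
          ∑ a ∈ Finset.Ico 1 L, B a := by
        intro l hl
        rw [Finset.mem_range] at hl
        calc _ ≤ ∑ l' ∈ Finset.range l, B (l - l') := by
              refine Finset.sum_le_sum fun l' hl' => ?_
              rw [Finset.mem_range] at hl'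
              have := hcross l' (l - l') (by omega) (by omega)
              rwa [show l' + (l - l') = l by omega] at this
          _ = ∑ a ∈ (Finset.range l).image (l - ·), B a := by
              rw [Finset.sum_image]
              intro a ha b hb h
              simp at ha hb h
              omega
          _ ≤ _ := by
              refine Finset.sum_le_sum_of_subset_of_nonneg ?_ fun a _ _ => hB0 a
              intro a ha
              simp only [Finset.mem_image, Finset.mem_range, Finset.mem_Ico] at ha ⊢
              omega
      refine (Finset.sum_le_sum this).trans ?_
      simp
    linarith
  have hNL : (L : ℝ) ≤ N := by exact_mod_cast hLN
  have hB' : 0 ≤ ∑ a ∈ Finset.Ico 1 L, B a := Finset.sum_nonneg fun a _ => hB0 a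
  have h7 : (L : ℝ) ^ 2 * ‖∑ j ∈ Finset.range N, z j‖ ^ 2 ≤
      (L : ℝ) ^ 2 * (2 * N / L * (N + 2 * ∑ a ∈ Finset.Ico 1 L, B a)) := by
    refine hmain.trans ?_
    have : (L : ℝ) ^ 2 * (2 * N / L * (N + 2 * ∑ a ∈ Finset.Ico 1 L, B a)) =
        (N + N) * (L * N + 2 * (L * ∑ a ∈ Finset.Ico 1 L, B a)) := by
      field_simp; ring
    rw [this]
    gcongr
  exact le_of_mul_le_mul_left h7 (by positivity)

theorem hyperbola_phase_increment {y a m : ℝ} (ha : 0 < a) (hm : 0 < m) :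
    (y / (m + 1 + a) - y / (m + 1)) - (y / (m + a) - y / m) =
      y * a * (1 / (m * (m + a) * (m + 1 + a)) + 1 / (m * (m + 1) * (m + 1 + a))) := by
  have h1 : m + a ≠ 0 := by positivity
  have h2 : m + 1 + a ≠ 0 := by positivity
  have h3 : m + 1 ≠ 0 := by positivity
  field_simp
  ring

/-- The differenced phase `y / (m + a) - y / m` has monotone increments of size about `y a / A³` on
`[A, 2A]`, so that the Kusmin–Landau inequality applies. -/
theorem norm_sum_differenced_hyperbola_le {A K a : ℕ} (ha : 1 ≤ a) (hK : K + a ≤ A) {y : ℝ}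
    (hy : 0 < y) (hya : 4 * y * a ≤ (A : ℝ) ^ 3) :
    ‖∑ j ∈ Finset.range K,
        e (y / (A + (j + a : ℕ))) * (starRingEnd ℂ) (e (y / (A + (j : ℕ))))‖ ≤
      6 * (A : ℝ) ^ 3 / y * (1 / a) := by
  have hA : (1 : ℝ) ≤ A := by exact_mod_cast (by omega : 1 ≤ A)
  have ha' : (1 : ℝ) ≤ a := by exact_mod_cast ha
  have hKA : (K : ℝ) + a ≤ A := by exact_mod_cast hK
  set G : ℝ → ℝ := fun m =>
    y * a * (1 / (m * (m + a) * (m + 1 + a)) + 1 / (m * (m + 1) * (m + 1 + a))) with hG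
  set f : ℕ → ℝ := fun j => y / (A + (j + a : ℕ)) - y / (A + (j : ℕ)) with hf
  have hinc : ∀ j : ℕ, f (j + 1) - f j = G (A + j) := by
    intro j
    simp only [hG]
    rw [← hyperbola_phase_increment (by positivity) (by positivity)]
    simp only [hf]; push_cast; ring_nf
  have hGanti : ∀ m m' : ℝ, 0 < m → m ≤ m' → G m' ≤ G m := by
    intro m m' h0 h
    have h0' : 0 < m' := h0.trans_le h
    simp only [hG]
    gcongr
  have h := norm_sum_e_le_of_antitone_increments f K (θ := y * a / (6 * (A : ℝ) ^ 3))
    (by positivity) ?_ ?_ ?_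
  · simp_rw [e_mul_conj_e]
    refine h.trans (le_of_eq ?_)
    field_simp
  · intro j hj
    have hj' : (j : ℝ) ≤ K := by exact_mod_cast hj
    rw [hinc]
    have h1 : G (2 * A - a) ≤ G (A + j) := hGanti _ _ (by positivity) (by linarith)
    refine le_trans ?_ h1
    simp only [hG]
    have hp : 0 < 2 * (A : ℝ) - a := by
      have : (0 : ℝ) ≤ K := by positivity
      linarith
    have h2 : 1 / (12 * (A : ℝ) ^ 3) ≤
        1 / ((2 * A - a) * (2 * A - a + a) * (2 * (A : ℝ) - a + 1 + a)) := by
      refine one_div_le_one_div_of_le (by positivity) ?_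
      calc _ ≤ (2 * (A : ℝ)) * (2 * A) * (3 * A) := by gcongr <;> linarith
        _ = _ := by ring
    have h3 : 1 / (12 * (A : ℝ) ^ 3) ≤
        1 / ((2 * A - a) * (2 * A - a + 1) * (2 * (A : ℝ) - a + 1 + a)) := by
      refine one_div_le_one_div_of_le (by positivity) ?_
      calc _ ≤ (2 * (A : ℝ)) * (2 * A) * (3 * A) := by gcongr <;> linarith
        _ = _ := by ring
    calc y * a / (6 * (A : ℝ) ^ 3) = y * a * (1 / (12 * (A : ℝ) ^ 3) + 1 / (12 * (A : ℝ) ^ 3)) := by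
          field_simp; norm_num
      _ ≤ _ := by gcongr
  · intro j hj
    rw [hinc]
    refine (hGanti A _ (by positivity) (by linarith [(Nat.cast_nonneg j : (0 : ℝ) ≤ j)])).trans ?_
    simp only [hG]
    have h2 : 1 / ((A : ℝ) * (A + a) * (A + 1 + a)) ≤ 1 / (A : ℝ) ^ 3 := by
      refine one_div_le_one_div_of_le (by positivity) ?_
      calc (A : ℝ) ^ 3 = A * A * A := by ring
        _ ≤ _ := by gcongr <;> linarith
    have h3 : 1 / ((A : ℝ) * (A + 1) * (A + 1 + a)) ≤ 1 / (A : ℝ) ^ 3 := by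
      refine one_div_le_one_div_of_le (by positivity) ?_
      calc (A : ℝ) ^ 3 = A * A * A := by ring
        _ ≤ _ := by gcongr <;> linarith
    calc _ ≤ y * a * (1 / (A : ℝ) ^ 3 + 1 / (A : ℝ) ^ 3) := by gcongr
      _ = 2 * y * a / (A : ℝ) ^ 3 := by ring
      _ ≤ 1 / 2 := by
        rw [div_le_iff₀ (by positivity)]; linarith
  · intro j hj
    rw [hinc, hinc]
    exact hGanti _ _ (by positivity) (by push_cast; linarith)

theorem sum_Ico_one_div_le (L : ℕ) : ∑ a ∈ Finset.Ico 1 L, (1 : ℝ) / a ≤ 1 + Real.log L := by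
  rcases Nat.eq_zero_or_pos L with rfl | hL
  · simp
  have h := harmonic_le_one_add_log L
  rw [harmonic_eq_sum_Icc] at h
  push_cast at h
  refine le_trans ?_ h
  simp_rw [one_div]
  exact Finset.sum_le_sum_of_subset_of_nonneg
    (fun x hx => by simp only [Finset.mem_Ico, Finset.mem_Icc] at hx ⊢; omega)
    fun _ _ _ => by positivity

/-- Second-derivative estimate for the exponential sum with phase `y / m` over part of `[A, 2A)`. -/
theorem norm_sum_e_div_sq_le {A N : ℕ} (hA : 1 ≤ A) (hN : N ≤ A) {y : ℝ} (hy : 0 < y)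
    (hyA : 4 * y ≤ (A : ℝ) ^ 3) :
    ‖∑ j ∈ Finset.range N, e (y / (A + (j : ℕ)))‖ ^ 2 ≤
      16 * y / A + (192 * A + 24 * ((A : ℝ) ^ 3 / y)) * (1 + Real.log A) := by
  have hA0 : (1 : ℝ) ≤ A := by exact_mod_cast hA
  have hlogA : 0 ≤ Real.log A := Real.log_nonneg hA0
  rcases Nat.eq_zero_or_pos N with rfl | hN0
  · rw [Finset.range_zero, Finset.sum_empty, norm_zero, zero_pow two_ne_zero]
    positivity
  have hN1 : (1 : ℝ) ≤ N := by exact_mod_cast hN0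
  have hNA : (N : ℝ) ≤ A := by exact_mod_cast hN
  have gen : ∀ L : ℕ, 1 ≤ L → L ≤ N → (L : ℝ) ≤ (A : ℝ) ^ 3 / (4 * y) →
      ‖∑ j ∈ Finset.range N, e (y / (A + (j : ℕ)))‖ ^ 2 ≤
        2 * N / L * (N + 12 * ((A : ℝ) ^ 3 / y) * (1 + Real.log A)) := by
    intro L hL hLN hLy
    have h := norm_sum_sq_le_of_differenced (fun j => e (y / (A + (j : ℕ)))) (fun _ => norm_e _)
      hL hLN (fun a => 6 * (A : ℝ) ^ 3 / y * (1 / a)) (fun a => by positivity) ?_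
    · refine h.trans ?_
      rw [← Finset.mul_sum]
      have h1 := sum_Ico_one_div_le L
      have h2 : Real.log L ≤ Real.log A :=
        Real.log_le_log (by exact_mod_cast hL) (by exact_mod_cast hLN.trans hN)
      have : 2 * (6 * (A : ℝ) ^ 3 / y * ∑ a ∈ Finset.Ico 1 L, (1 : ℝ) / a) ≤
          12 * ((A : ℝ) ^ 3 / y) * (1 + Real.log A) := by
        calc _ = 12 * ((A : ℝ) ^ 3 / y) * ∑ a ∈ Finset.Ico 1 L, (1 : ℝ) / a := by ring
          _ ≤ _ := by gcongr; linarith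
      gcongr
    · intro a ha haL
      refine norm_sum_differenced_hyperbola_le ha (by omega) hy ?_
      rw [le_div_iff₀ (by positivity)] at hLy
      have : (a : ℝ) ≤ L := by exact_mod_cast haL.le
      nlinarith
  have hA3 : (0 : ℝ) < (A : ℝ) ^ 3 := by positivity
  by_cases hcase : (N : ℝ) ≤ (A : ℝ) ^ 3 / (4 * y)
  · refine (gen N hN0 le_rfl hcase).trans ?_
    rw [mul_div_assoc, div_self (by positivity), mul_one]
    have : 0 ≤ 16 * y / A := by positivity
    nlinarith [mul_nonneg hlogA (by positivity : (0 : ℝ) ≤ A)]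
  · push Not at hcase
    have hq1 : 1 ≤ (A : ℝ) ^ 3 / (4 * y) := by
      rw [le_div_iff₀ (by positivity)]; linarith
    -- The longest shift for which the increments of the differenced phase stay below `1/2`.
    set L := ⌊(A : ℝ) ^ 3 / (4 * y)⌋₊ with hLdef
    have hL1 : 1 ≤ L := by
      rw [hLdef, Nat.one_le_floor_iff]; exact hq1
    have hLle : (L : ℝ) ≤ (A : ℝ) ^ 3 / (4 * y) := Nat.floor_le (by positivity)
    have hLN : L ≤ N := by
      have : (L : ℝ) ≤ N := hLle.trans hcase.le
      exact_mod_cast this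
    refine (gen L hL1 hLN hLle).trans ?_
    have hL2 : (A : ℝ) ^ 3 / (8 * y) ≤ L := by
      have h1 := Nat.lt_floor_add_one ((A : ℝ) ^ 3 / (4 * y))
      rw [← hLdef] at h1
      have h2 : (1 : ℝ) ≤ L := by exact_mod_cast hL1
      have h3 : (A : ℝ) ^ 3 / (8 * y) = (A : ℝ) ^ 3 / (4 * y) / 2 := by field_simp; norm_num
      rw [h3]; linarith
    have hLinv : 2 * N / (L : ℝ) ≤ 16 * N * y / (A : ℝ) ^ 3 := by
      have : 0 < (A : ℝ) ^ 3 / (8 * y) := by positivity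
      calc 2 * N / (L : ℝ) ≤ 2 * N / ((A : ℝ) ^ 3 / (8 * y)) := by gcongr
        _ = _ := by field_simp; norm_num
    calc _ ≤ 16 * N * y / (A : ℝ) ^ 3 * (N + 12 * ((A : ℝ) ^ 3 / y) * (1 + Real.log A)) := by
          gcongr
      _ = 16 * y * (N * N) / (A : ℝ) ^ 3 + 192 * N * (1 + Real.log A) := by field_simp; ring
      _ ≤ 16 * y * (A * A) / (A : ℝ) ^ 3 + 192 * A * (1 + Real.log A) := by gcongr
      _ = 16 * y / A + 192 * A * (1 + Real.log A) := by field_simp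
      _ ≤ _ := by
        have : 0 ≤ 24 * ((A : ℝ) ^ 3 / y) * (1 + Real.log A) := by positivity
        linarith

/-- Lower bound for the Fejér kernel close to an integer. -/
theorem four_mul_sq_div_pi_sq_le_fejer {H : ℕ} (hH : 1 ≤ H) {t : ℝ} {q : ℤ}
    (ht : |t - q| ≤ 1 / (2 * H)) :
    4 * (H : ℝ) ^ 2 / Real.pi ^ 2 ≤ ‖∑ h ∈ Finset.range H, e (h * t)‖ ^ 2 := by
  have hH1 : (1 : ℝ) ≤ H := by exact_mod_cast hH
  have hpi := Real.pi_gt_three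
  set s := t - q with hs
  have het : e t = e s := by
    rw [show t = s + q by rw [hs]; ring, e_add, e_intCast, mul_one]
  have hsum : ∑ h ∈ Finset.range H, e (h * t) = ∑ h ∈ Finset.range H, e s ^ h := by
    refine Finset.sum_congr rfl fun h _ => ?_
    rw [e_natCast_mul, het]
  rw [hsum]
  by_cases hs0 : s = 0
  · have : e s = 1 := by rw [hs0]; simpa using e_intCast 0
    simp only [this, one_pow, Finset.sum_const, Finset.card_range, nsmul_eq_mul, mul_one,
      Complex.norm_natCast]
    rw [div_le_iff₀ (by positivity)]
    rw [mul_comm]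
    gcongr
    nlinarith
  have habs : 0 < |s| := abs_pos.2 hs0
  have hgeom := mul_geom_sum (e s) H
  rw [← e_natCast_mul] at hgeom
  have hnorm := congrArg norm hgeom
  rw [norm_mul, norm_e_sub_one, norm_e_sub_one] at hnorm
  have habs_sin : ∀ x : ℝ, |x| ≤ 1 / 2 → 2 * |x| ≤ |Real.sin (Real.pi * x)| := by
    intro x hx
    rcases le_total 0 x with h | h
    · rw [abs_of_nonneg h] at hx ⊢
      exact (two_mul_le_sin_pi_mul h hx).trans (le_abs_self _)
    · rw [abs_of_nonpos h] at hx ⊢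
      have := two_mul_le_sin_pi_mul (x := -x) (by linarith) hx
      rw [mul_neg Real.pi, Real.sin_neg] at this
      exact this.trans (neg_le_abs _)
  have hHs : |(H : ℝ) * s| ≤ 1 / 2 := by
    rw [abs_mul, abs_of_pos (by linarith)]
    calc (H : ℝ) * |s| ≤ H * (1 / (2 * H)) := by gcongr
      _ = 1 / 2 := by field_simp
  have h1 := habs_sin _ hHs
  rw [abs_mul, abs_of_pos (show (0 : ℝ) < H by linarith)] at h1
  have h2 : |Real.sin (Real.pi * s)| ≤ Real.pi * |s| := by
    refine Real.abs_sin_le_abs.trans ?_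
    rw [abs_mul, abs_of_pos Real.pi_pos]
  set D := ‖∑ h ∈ Finset.range H, e s ^ h‖
  have hD : 0 ≤ D := norm_nonneg _
  have h3 : 2 * H / Real.pi ≤ D := by
    rw [div_le_iff₀ Real.pi_pos]
    have : 2 * (H * |s|) ≤ Real.pi * |s| * D := by
      calc _ ≤ |Real.sin (Real.pi * (H * s))| := h1
        _ = |Real.sin (Real.pi * s)| * D := by linarith
        _ ≤ _ := by gcongr
    refine le_of_mul_le_mul_right ?_ habs
    linarith
  calc _ = (2 * H / Real.pi) ^ 2 := by ring
    _ ≤ D ^ 2 := by gcongr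

/-! ### Selberg's upper bound sieve -/

/-- The sum of `μ²(m) / φ(m)` over `m ≤ R` that governs the main term of the Selberg sieve. -/
noncomputable def selbergSum (R : ℕ) : ℝ :=
  ∑ m ∈ (Finset.Icc 1 R).filter Squarefree, 1 / (Nat.totient m : ℝ)

/-- The numbers up to `R` whose set of prime factors is that of the squarefree number `m`
contribute at most `∏_{p ∣ m} (1/p + 1/p² + ⋯) = 1 / φ(m)` to the harmonic sum. -/
theorem sum_one_div_of_primeFactors_eq_le (R : ℕ) {m : ℕ} (hm : Squarefree m) :
    ∑ a ∈ (Finset.Icc 1 R).filter (fun a => a.primeFactors = m.primeFactors), 1 / (a : ℝ) ≤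
      1 / (Nat.totient m : ℝ) := by
  set P := m.primeFactors with hP
  have hPp : ∀ p ∈ P, p.Prime := fun p hp => Nat.prime_of_mem_primeFactors hp
  have hphi : (1 : ℝ) / Nat.totient m = ∏ p ∈ P, 1 / ((p : ℝ) - 1) := by
    have h := Nat.totient_mul_prod_primeFactors m
    rw [Nat.prod_primeFactors_of_squarefree hm, mul_comm] at h
    have h' := Nat.eq_of_mul_eq_mul_left (Nat.pos_of_ne_zero hm.ne_zero) h
    rw [h']
    push_cast
    rw [Finset.prod_div_distrib, Finset.prod_const_one]
    congr 1
    refine Finset.prod_congr rfl fun p hp => ?_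
    rw [Nat.cast_sub (hPp p hp).one_le, Nat.cast_one]
  have hgeom : ∀ p ∈ P, ∑ k ∈ Finset.Icc 1 R, (1 / (p : ℝ)) ^ k ≤ 1 / ((p : ℝ) - 1) := by
    intro p hp
    have hp2 : (2 : ℝ) ≤ p := by exact_mod_cast (hPp p hp).two_le
    have h1 : ∀ K : ℕ, ∑ k ∈ Finset.Icc 1 K, (1 / (p : ℝ)) ^ k =
        1 / ((p : ℝ) - 1) - (1 / (p : ℝ)) ^ K / (p - 1) := by
      intro K
      have hne : (p : ℝ) - 1 ≠ 0 := by linarith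
      induction K with
      | zero => simp
      | succ K ih =>
        rw [Finset.sum_Icc_succ_top (by omega), ih, pow_succ]
        field_simp
        ring
    rw [h1]
    have : 0 ≤ (1 / (p : ℝ)) ^ R / (p - 1) := div_nonneg (by positivity) (by linarith)
    linarith
  rw [hphi]
  refine le_trans ?_ (Finset.prod_le_prod (fun p _ => by positivity) hgeom)
  rw [Finset.prod_sum]
  set F : ℕ → (∀ p ∈ P, ℕ) := fun a p _ => a.factorization p with hF
  have hmem : ∀ a ∈ (Finset.Icc 1 R).filter (fun a => a.primeFactors = P),
      F a ∈ P.pi fun _ => Finset.Icc 1 R := by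
    intro a ha
    rw [Finset.mem_filter, Finset.mem_Icc] at ha
    rw [Finset.mem_pi]
    intro p hp
    rw [Finset.mem_Icc]
    rw [← ha.2, Nat.mem_primeFactors] at hp
    refine ⟨hp.1.factorization_pos_of_dvd hp.2.2 hp.2.1, ?_⟩
    exact ((Nat.factorization_lt p hp.2.2).le).trans ha.1.2
  have hval : ∀ a ∈ (Finset.Icc 1 R).filter (fun a => a.primeFactors = P),
      (a : ℝ) = ∏ p ∈ P, (p : ℝ) ^ a.factorization p := by
    intro a ha
    rw [Finset.mem_filter, Finset.mem_Icc] at ha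
    have h := Nat.prod_factorization_pow_eq_self (n := a) (by omega)
    rw [Finsupp.prod, Nat.support_factorization, ha.2] at h
    exact_mod_cast h.symm
  have hinj : Set.InjOn F ((Finset.Icc 1 R).filter (fun a => a.primeFactors = P)) := by
    intro a ha b hb hab
    have ha' := hval a ha
    have hb' := hval b hb
    have : (a : ℝ) = b := by
      rw [ha', hb']
      refine Finset.prod_congr rfl fun p hp => ?_
      have : a.factorization p = b.factorization p := congrFun (congrFun hab p) hp
      rw [this]
    exact_mod_cast this
  calc ∑ a ∈ (Finset.Icc 1 R).filter (fun a => a.primeFactors = P), 1 / (a : ℝ) =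
      ∑ a ∈ (Finset.Icc 1 R).filter (fun a => a.primeFactors = P),
        ∏ p ∈ P.attach, (1 / (p.1 : ℝ)) ^ (F a p.1 p.2) := by
        refine Finset.sum_congr rfl fun a ha => ?_
        conv_lhs => rw [hval a ha]
        rw [← Finset.prod_attach P, one_div, ← Finset.prod_inv_distrib]
        refine Finset.prod_congr rfl fun p _ => ?_
        rw [one_div, inv_pow]
    _ = ∑ f ∈ ((Finset.Icc 1 R).filter (fun a => a.primeFactors = P)).image F,
        ∏ p ∈ P.attach, (1 / (p.1 : ℝ)) ^ (f p.1 p.2) := by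
        rw [Finset.sum_image hinj]
    _ ≤ _ := by
        refine Finset.sum_le_sum_of_subset_of_nonneg ?_ fun _ _ _ => by positivity
        intro f hf
        obtain ⟨a, ha, rfl⟩ := Finset.mem_image.1 hf
        exact hmem a ha

theorem log_le_selbergSum (R : ℕ) : Real.log (R + 1) ≤ selbergSum R := by
  have h1 : Real.log (R + 1) ≤ ∑ a ∈ Finset.Icc 1 R, 1 / (a : ℝ) := by
    have := log_add_one_le_harmonic R
    rw [harmonic_eq_sum_Icc] at this
    push_cast at this
    simpa [one_div] using this
  refine h1.trans ?_
  have hmaps : ∀ a ∈ Finset.Icc 1 R, ∏ p ∈ a.primeFactors, p ∈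
      (Finset.Icc 1 R).filter Squarefree := by
    intro a ha
    rw [Finset.mem_Icc] at ha
    rw [Finset.mem_filter, Finset.mem_Icc]
    refine ⟨⟨?_, ?_⟩, ?_⟩
    · exact Finset.prod_pos fun p hp => (Nat.prime_of_mem_primeFactors hp).pos
    · exact (Nat.le_of_dvd ha.1 (Nat.prod_primeFactors_dvd a)).trans ha.2
    · refine Finset.squarefree_prod_of_pairwise_isCoprime (fun p hp q hq hpq => ?_) fun p hp =>
        (Nat.prime_of_mem_primeFactors hp).squarefree
      exact Nat.coprime_iff_isRelPrime.1 ((Nat.coprime_primes (Nat.prime_of_mem_primeFactors hp)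
        (Nat.prime_of_mem_primeFactors hq)).2 hpq)
  rw [← Finset.sum_fiberwise_of_maps_to hmaps, selbergSum]
  refine Finset.sum_le_sum fun m hm => ?_
  have hsq := (Finset.mem_filter.1 hm).2
  refine le_trans (Finset.sum_le_sum_of_subset_of_nonneg ?_ fun _ _ _ => by positivity)
    (sum_one_div_of_primeFactors_eq_le R hsq)
  intro a ha
  rw [Finset.mem_filter] at ha ⊢
  refine ⟨ha.1, ?_⟩
  rw [← ha.2, Nat.primeFactors_prod]
  exact fun p hp => Nat.prime_of_mem_primeFactors hp

/-- Selberg's weights `λ_d = d ∑_{d ∣ m ≤ R} μ(m / d) y_m` with `y_m = μ(m) / (φ(m) S)`, the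
minimizer of the quadratic form `∑ λ_a λ_b / [a, b]` under `λ_1 = 1`. -/
noncomputable def selbergWeight (R d : ℕ) : ℝ :=
  d * ∑ m ∈ (Finset.Icc 1 R).filter (d ∣ ·),
    (ArithmeticFunction.moebius (m / d) : ℝ) *
      ((ArithmeticFunction.moebius m : ℝ) / (Nat.totient m * selbergSum R))

theorem one_le_selbergSum {R : ℕ} (hR : 1 ≤ R) : 1 ≤ selbergSum R := by
  have h := Finset.single_le_sum (f := fun m : ℕ => 1 / (Nat.totient m : ℝ))
    (s := (Finset.Icc 1 R).filter Squarefree) (fun _ _ => by positivity)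
    (a := 1) (by simp [hR])
  simpa [selbergSum] using h

theorem moebius_sq_real (m : ℕ) :
    (ArithmeticFunction.moebius m : ℝ) ^ 2 = if Squarefree m then 1 else 0 := by
  have := ArithmeticFunction.moebius_sq (n := m)
  exact_mod_cast this

theorem selbergSum_eq (R : ℕ) : selbergSum R =
    ∑ m ∈ Finset.Icc 1 R, (ArithmeticFunction.moebius m : ℝ) ^ 2 / Nat.totient m := by
  rw [selbergSum, Finset.sum_filter]
  refine Finset.sum_congr rfl fun m _ => ?_
  rw [moebius_sq_real]
  split_ifs <;> simp

theorem selbergWeight_one {R : ℕ} (hR : 1 ≤ R) : selbergWeight R 1 = 1 := by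
  have hS := one_le_selbergSum hR
  rw [selbergWeight]
  simp only [Nat.cast_one, one_dvd, Finset.filter_true, Nat.div_one, one_mul]
  have : ∀ m ∈ Finset.Icc 1 R, (ArithmeticFunction.moebius m : ℝ) *
      ((ArithmeticFunction.moebius m : ℝ) / (Nat.totient m * selbergSum R)) =
      (ArithmeticFunction.moebius m : ℝ) ^ 2 / Nat.totient m * (1 / selbergSum R) := by
    intro m _; ring
  rw [Finset.sum_congr rfl this, ← Finset.sum_mul, ← selbergSum_eq]
  field_simp

/-- Selberg's bound `|λ_d| ≤ 1`. Writing `d = ∑_{l ∣ d} φ(l)`, it says that the sum of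
`φ(l) / φ(m) = 1 / φ(m / l)` over `l ∣ d` and squarefree multiples `m ≤ R` of `d` is at most
`selbergSum R`, which holds because the quotients `m / l` are distinct squarefree numbers. -/
theorem abs_selbergWeight_le_one {R : ℕ} (hR : 1 ≤ R) (d : ℕ) : |selbergWeight R d| ≤ 1 := by
  have hS := one_le_selbergSum hR
  rcases Nat.eq_zero_or_pos d with rfl | hd
  · simp [selbergWeight]
  set M := ((Finset.Icc 1 R).filter (d ∣ ·)).filter Squarefree with hM
  have h1 : |selbergWeight R d| ≤ d * ∑ m ∈ M, 1 / (Nat.totient m : ℝ) * (1 / selbergSum R) := by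
    rw [selbergWeight, abs_mul, Nat.abs_cast]
    gcongr
    refine (Finset.abs_sum_le_sum_abs _ _).trans ?_
    rw [hM, Finset.sum_filter (p := Squarefree)]
    refine Finset.sum_le_sum fun m _ => ?_
    have hmu : ∀ k : ℕ, |(ArithmeticFunction.moebius k : ℝ)| ≤ 1 := fun k => by
      exact_mod_cast ArithmeticFunction.abs_moebius_le_one (n := k)
    split_ifs with hm
    · rw [abs_mul, abs_div,
        abs_of_nonneg (show 0 ≤ (Nat.totient m : ℝ) * selbergSum R by positivity)]
      calc _ ≤ 1 * (1 / ((Nat.totient m : ℝ) * selbergSum R)) := by gcongr <;> exact hmu _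
        _ = _ := by rw [one_mul, one_div_mul_one_div]
    · rw [ArithmeticFunction.moebius_eq_zero_of_not_squarefree hm]; simp
  have h2 : (d : ℝ) * ∑ m ∈ M, 1 / (Nat.totient m : ℝ) ≤ selbergSum R := by
    have hdsum : (d : ℝ) = ∑ l ∈ d.divisors, (Nat.totient l : ℝ) := by
      exact_mod_cast (Nat.sum_totient d).symm
    have hMprop : ∀ m ∈ M, 1 ≤ m ∧ m ≤ R ∧ d ∣ m ∧ Squarefree m := by
      intro m hm
      simp only [hM, Finset.mem_filter, Finset.mem_Icc] at hm
      exact ⟨hm.1.1.1, hm.1.1.2, hm.1.2, hm.2⟩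
    have hinj : Set.InjOn (fun x : ℕ × ℕ => x.2 / x.1) (d.divisors ×ˢ M : Finset (ℕ × ℕ)) := by
      -- The greatest common divisor of `m / l` and `d` is `d / l`, which recovers `l` and `m`.
      have hg : ∀ l m, l ∣ d → d ∣ m → Squarefree m → Nat.gcd (m / l) d = d / l := by
        rintro l m ⟨c, rfl⟩ ⟨b, rfl⟩ hsq
        have hl : 0 < l := Nat.pos_of_ne_zero (by rintro rfl; simp at hd)
        rw [mul_assoc, Nat.mul_div_cancel_left _ hl, Nat.mul_div_cancel_left _ hl, mul_comm l c,
          Nat.gcd_mul_left]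
        have hbl : Nat.Coprime b l := by
          refine Nat.Coprime.symm (Nat.coprime_of_squarefree_mul (m := l) (n := b) ?_)
          exact hsq.squarefree_of_dvd ⟨c, by ring⟩
        rw [hbl.gcd_eq_one, mul_one]
      rintro ⟨l, m⟩ h ⟨l', m'⟩ h' heq
      simp only [Finset.coe_product, Set.mem_prod, Finset.mem_coe, Nat.mem_divisors] at h h' heq
      obtain ⟨_, _, hdm, hsq⟩ := hMprop m h.2
      obtain ⟨_, _, hdm', hsq'⟩ := hMprop m' h'.2
      have e1 := hg l m h.1.1 hdm hsq
      have e2 := hg l' m' h'.1.1 hdm' hsq'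
      rw [heq, e2] at e1
      have hll : l = l' := by
        have f1 := Nat.div_mul_cancel h.1.1
        have f2 := Nat.div_mul_cancel h'.1.1
        rw [e1] at f2
        have : 0 < d / l := Nat.div_pos (Nat.le_of_dvd hd h.1.1) (Nat.pos_of_dvd_of_pos h.1.1 hd)
        exact Nat.eq_of_mul_eq_mul_left this (f1.trans f2.symm)
      subst hll
      have f1 := Nat.div_mul_cancel (h.1.1.trans hdm)
      have f2 := Nat.div_mul_cancel (h.1.1.trans hdm')
      rw [← f1, ← f2, heq]
    rw [hdsum, Finset.sum_mul_sum, ← Finset.sum_product']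
    calc ∑ x ∈ d.divisors ×ˢ M, (Nat.totient x.1 : ℝ) * (1 / (Nat.totient x.2 : ℝ)) =
        ∑ x ∈ d.divisors ×ˢ M, 1 / (Nat.totient (x.2 / x.1) : ℝ) := by
          refine Finset.sum_congr rfl ?_
          rintro ⟨l, m⟩ hx
          simp only [Finset.mem_product, Nat.mem_divisors] at hx ⊢
          obtain ⟨hm1, _, hdm, hsq⟩ := hMprop m hx.2
          obtain ⟨b, rfl⟩ := hx.1.1.trans hdm
          have hl : 0 < l := Nat.pos_of_ne_zero (by rintro rfl; simp at hm1)
          have hb : 0 < b := Nat.pos_of_ne_zero (by rintro rfl; simp at hm1)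
          rw [Nat.mul_div_cancel_left _ hl, Nat.totient_mul (Nat.coprime_of_squarefree_mul hsq)]
          have h1 : (Nat.totient l : ℝ) ≠ 0 := by exact_mod_cast (Nat.totient_pos.2 hl).ne'
          have h2 : (Nat.totient b : ℝ) ≠ 0 := by exact_mod_cast (Nat.totient_pos.2 hb).ne'
          push_cast
          field_simp
      _ = ∑ k ∈ (d.divisors ×ˢ M).image (fun x : ℕ × ℕ => x.2 / x.1), 1 / (Nat.totient k : ℝ) := by
          rw [Finset.sum_image hinj]
      _ ≤ _ := by
          refine Finset.sum_le_sum_of_subset_of_nonneg ?_ fun _ _ _ => by positivity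
          intro k hk
          obtain ⟨⟨l, m⟩, hx, rfl⟩ := Finset.mem_image.1 hk
          simp only [Finset.mem_product, Nat.mem_divisors] at hx
          obtain ⟨hm1, hmR, hdm, hsq⟩ := hMprop m hx.2
          have hlm := hx.1.1.trans hdm
          simp only [Finset.mem_filter, Finset.mem_Icc]
          exact ⟨⟨Nat.div_pos (Nat.le_of_dvd hm1 hlm) (Nat.pos_of_dvd_of_pos hlm hm1),
            (Nat.div_le_self _ _).trans hmR⟩, hsq.squarefree_of_dvd (Nat.div_dvd_of_dvd hlm)⟩
  refine h1.trans ?_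
  rw [← Finset.sum_mul, ← mul_assoc, mul_one_div]
  exact (div_le_one (by linarith)).2 h2

theorem sum_selbergWeight_div {R k : ℕ} (hk : k ∈ Finset.Icc 1 R) :
    ∑ d ∈ (Finset.Icc 1 R).filter (k ∣ ·), selbergWeight R d / d =
      (ArithmeticFunction.moebius k : ℝ) / (Nat.totient k * selbergSum R) := by
  rw [Finset.mem_Icc] at hk
  set y : ℕ → ℝ := fun m => (ArithmeticFunction.moebius m : ℝ) / (Nat.totient m * selbergSum R)
    with hy
  have h1 : ∀ d ∈ (Finset.Icc 1 R).filter (k ∣ ·), selbergWeight R d / d =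
      ∑ m ∈ Finset.Icc 1 R,
        if d ∣ m then (ArithmeticFunction.moebius (m / d) : ℝ) * y m else 0 := by
    intro d hd
    rw [Finset.mem_filter, Finset.mem_Icc] at hd
    have : (d : ℝ) ≠ 0 := by
      have : d ≠ 0 := by omega
      exact_mod_cast this
    rw [selbergWeight, mul_div_cancel_left₀ _ this, Finset.sum_filter]
  rw [Finset.sum_congr rfl h1, Finset.sum_comm]
  have h2 : ∀ m ∈ Finset.Icc 1 R, (∑ d ∈ (Finset.Icc 1 R).filter (k ∣ ·),
      if d ∣ m then (ArithmeticFunction.moebius (m / d) : ℝ) * y m else 0) =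
      if m = k then y k else 0 := by
    intro m hm
    rw [Finset.mem_Icc] at hm
    rw [← Finset.sum_filter, ← Finset.sum_mul]
    by_cases hkm : k ∣ m
    · obtain ⟨b, rfl⟩ := hkm
      have hb : b ≠ 0 := by rintro rfl; simp at hm
      have h3 : ∑ d ∈ ((Finset.Icc 1 R).filter (k ∣ ·)).filter (· ∣ k * b),
          (ArithmeticFunction.moebius (k * b / d) : ℝ) =
          ∑ c ∈ b.divisors, (ArithmeticFunction.moebius (b / c) : ℝ) := by
        symm
        refine Finset.sum_bij' (fun c _ => k * c) (fun d _ => d / k) ?_ ?_ ?_ ?_ ?_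
        · intro c hc
          have hc' := Nat.mem_divisors.1 hc
          simp only [Finset.mem_filter, Finset.mem_Icc]
          have hcb := Nat.le_of_dvd (Nat.pos_of_ne_zero hb) hc'.1
          have hc0 : 0 < c := Nat.pos_of_mem_divisors hc
          refine ⟨⟨⟨Nat.mul_pos (by omega) hc0, ?_⟩, dvd_mul_right _ _⟩,
            Nat.mul_dvd_mul_left k hc'.1⟩
          exact (Nat.mul_le_mul_left k hcb).trans hm.2
        · intro d hd
          simp only [Finset.mem_filter, Finset.mem_Icc] at hd
          obtain ⟨⟨_, c, rfl⟩, h⟩ := hd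
          rw [Nat.mul_div_cancel_left _ (by omega), Nat.mem_divisors]
          exact ⟨Nat.dvd_of_mul_dvd_mul_left (by omega) h, hb⟩
        · intro c _
          rw [Nat.mul_div_cancel_left _ (by omega)]
        · intro d hd
          simp only [Finset.mem_filter] at hd
          exact Nat.mul_div_cancel' hd.1.2
        · intro c _
          rw [Nat.mul_div_mul_left _ _ (by omega)]
      rw [h3]
      have h4 : ∑ c ∈ b.divisors, (ArithmeticFunction.moebius (b / c) : ℝ) =
          if b = 1 then 1 else 0 := by
        rw [Nat.sum_div_divisors b (fun c => (ArithmeticFunction.moebius c : ℝ))]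
        have := congrArg (fun f : ArithmeticFunction ℤ => f b)
          ArithmeticFunction.moebius_mul_coe_zeta
        rw [ArithmeticFunction.coe_mul_zeta_apply, ArithmeticFunction.one_apply] at this
        exact_mod_cast this
      rw [h4]
      by_cases hb1 : b = 1
      · subst hb1; simp
      · rw [if_neg hb1, if_neg, zero_mul]
        intro h
        apply hb1
        exact Nat.eq_of_mul_eq_mul_left (by omega : 0 < k) (by omega)
    · rw [if_neg (by rintro rfl; exact hkm dvd_rfl), Finset.sum_eq_zero, zero_mul]
      intro d hd
      simp only [Finset.mem_filter] at hd
      exact absurd (hd.1.2.trans hd.2) hkm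
  rw [Finset.sum_congr rfl h2]
  simp [hk, hy]

/-- The diagonalized quadratic form of the Selberg sieve takes the value `1 / S`. -/
theorem sum_selbergWeight_mul_div_lcm {R : ℕ} (hR : 1 ≤ R) :
    ∑ a ∈ Finset.Icc 1 R, ∑ b ∈ Finset.Icc 1 R,
      selbergWeight R a * selbergWeight R b / (Nat.lcm a b : ℝ) = 1 / selbergSum R := by
  have hS := one_le_selbergSum hR
  have h1 : ∀ a ∈ Finset.Icc 1 R, ∀ b ∈ Finset.Icc 1 R,
      selbergWeight R a * selbergWeight R b / (Nat.lcm a b : ℝ) =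
      ∑ k ∈ Finset.Icc 1 R, (Nat.totient k : ℝ) *
        ((if k ∣ a then selbergWeight R a / a else 0) *
          (if k ∣ b then selbergWeight R b / b else 0)) := by
    intro a ha b hb
    rw [Finset.mem_Icc] at ha hb
    have hg : (Nat.gcd a b : ℝ) = ∑ k ∈ Finset.Icc 1 R,
        if k ∣ a ∧ k ∣ b then (Nat.totient k : ℝ) else 0 := by
      rw [← Finset.sum_filter]
      conv_lhs => rw [← Nat.sum_totient (Nat.gcd a b)]
      push_cast
      refine Finset.sum_congr ?_ fun _ _ => rfl
      ext k
      have hgp : 0 < Nat.gcd a b := Nat.gcd_pos_of_pos_left _ (by omega)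
      simp only [Nat.mem_divisors, Finset.mem_filter, Finset.mem_Icc, Nat.dvd_gcd_iff]
      constructor
      · rintro ⟨h, _⟩
        refine ⟨⟨Nat.pos_of_dvd_of_pos h.1 (by omega), ?_⟩, h⟩
        exact (Nat.le_of_dvd (by omega) h.1).trans ha.2
      · rintro ⟨_, h⟩
        exact ⟨h, hgp.ne'⟩
    have hab : (Nat.gcd a b : ℝ) * (Nat.lcm a b : ℝ) = a * b := by
      exact_mod_cast Nat.gcd_mul_lcm a b
    have ha0 : (a : ℝ) ≠ 0 := by have : a ≠ 0 := by omega
                                 exact_mod_cast this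
    have hb0 : (b : ℝ) ≠ 0 := by have : b ≠ 0 := by omega
                                 exact_mod_cast this
    have hl0 : (Nat.lcm a b : ℝ) ≠ 0 := by
      have := Nat.lcm_ne_zero (m := a) (n := b) (by omega) (by omega)
      exact_mod_cast this
    have h2 : selbergWeight R a * selbergWeight R b / (Nat.lcm a b : ℝ) =
        (Nat.gcd a b : ℝ) * (selbergWeight R a / a * (selbergWeight R b / b)) := by
      field_simp
      linear_combination -(selbergWeight R a * selbergWeight R b) * hab
    rw [h2, hg, Finset.sum_mul]
    refine Finset.sum_congr rfl fun k _ => ?_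
    by_cases h3 : k ∣ a <;> by_cases h4 : k ∣ b <;> simp [h3, h4]
  rw [Finset.sum_congr rfl fun a ha => Finset.sum_congr rfl (h1 a ha)]
  have h5 : ∑ a ∈ Finset.Icc 1 R, ∑ b ∈ Finset.Icc 1 R, ∑ k ∈ Finset.Icc 1 R,
      (Nat.totient k : ℝ) * ((if k ∣ a then selbergWeight R a / a else 0) *
          (if k ∣ b then selbergWeight R b / b else 0)) =
      ∑ k ∈ Finset.Icc 1 R, (Nat.totient k : ℝ) *
        (∑ d ∈ (Finset.Icc 1 R).filter (k ∣ ·), selbergWeight R d / d) ^ 2 := by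
    rw [Finset.sum_congr rfl fun a _ => Finset.sum_comm, Finset.sum_comm]
    refine Finset.sum_congr rfl fun k _ => ?_
    simp only [Finset.sum_filter]
    rw [sq, Finset.sum_mul_sum, Finset.mul_sum]
    refine Finset.sum_congr rfl fun a _ => ?_
    rw [Finset.mul_sum]
  rw [h5]
  have h6 : ∀ k ∈ Finset.Icc 1 R, (Nat.totient k : ℝ) *
        (∑ d ∈ (Finset.Icc 1 R).filter (k ∣ ·), selbergWeight R d / d) ^ 2 =
      (ArithmeticFunction.moebius k : ℝ) ^ 2 / Nat.totient k * (1 / selbergSum R ^ 2) := by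
    intro k hk
    rw [sum_selbergWeight_div hk]
    rw [Finset.mem_Icc] at hk
    have : (Nat.totient k : ℝ) ≠ 0 := by
      have := (Nat.totient_pos.2 (by omega : 0 < k)).ne'
      exact_mod_cast this
    field_simp
  rw [Finset.sum_congr rfl h6, ← Finset.sum_mul, ← selbergSum_eq]
  field_simp

/-- Selberg's sieve for primes: if the weights `a m` are nearly equidistributed over the multiples
of each `d ≤ R²`, their sum over primes exceeding `R` is at most `X / log R` up to an error. -/
theorem sum_prime_le_of_equidistributed (s : Finset ℕ) (a : ℕ → ℝ) (ha : ∀ m, 0 ≤ a m) {R : ℕ}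
    (hR : 1 ≤ R) (hs : ∀ m ∈ s, R < m) {X E : ℝ} (hX : 0 ≤ X)
    (hE : ∀ d, 1 ≤ d → d ≤ R ^ 2 → |∑ m ∈ s.filter (d ∣ ·), a m - X / d| ≤ E) :
    ∑ p ∈ s.filter Nat.Prime, a p ≤ X / Real.log (R + 1) + R ^ 2 * E := by
  set lam := selbergWeight R with hlam
  have h1 : ∑ p ∈ s.filter Nat.Prime, a p ≤
      ∑ m ∈ s, a m * (∑ d ∈ (Finset.Icc 1 R).filter (· ∣ m), lam d) ^ 2 := by
    refine le_trans (le_of_eq ?_) (Finset.sum_le_sum_of_subset_of_nonneg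
      (Finset.filter_subset Nat.Prime s) fun m _ _ => mul_nonneg (ha m) (sq_nonneg _))
    refine Finset.sum_congr rfl fun p hp => ?_
    rw [Finset.mem_filter] at hp
    have : (Finset.Icc 1 R).filter (· ∣ p) = {1} := by
      ext d
      rw [Finset.mem_filter, Finset.mem_Icc, Finset.mem_singleton]
      constructor
      · rintro ⟨hd, hdp⟩
        rcases (Nat.dvd_prime hp.2).1 hdp with h | h
        · exact h
        · have := hs p hp.1; omega
      · rintro rfl; exact ⟨⟨le_rfl, hR⟩, one_dvd _⟩
    rw [this, Finset.sum_singleton, hlam, selbergWeight_one hR]; ring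
  have h2 : ∑ m ∈ s, a m * (∑ d ∈ (Finset.Icc 1 R).filter (· ∣ m), lam d) ^ 2 =
      ∑ c ∈ Finset.Icc 1 R, ∑ d ∈ Finset.Icc 1 R, lam c * lam d *
        ∑ m ∈ s.filter (Nat.lcm c d ∣ ·), a m := by
    have h3 : ∀ m ∈ s, a m * (∑ d ∈ (Finset.Icc 1 R).filter (· ∣ m), lam d) ^ 2 =
        ∑ c ∈ Finset.Icc 1 R, ∑ d ∈ Finset.Icc 1 R,
          if Nat.lcm c d ∣ m then lam c * lam d * a m else 0 := by
      intro m _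
      rw [Finset.sum_filter, sq, Finset.sum_mul_sum, Finset.mul_sum]
      refine Finset.sum_congr rfl fun c _ => ?_
      rw [Finset.mul_sum]
      refine Finset.sum_congr rfl fun d _ => ?_
      by_cases h3 : c ∣ m <;> by_cases h4 : d ∣ m <;> simp [h3, h4, Nat.lcm_dvd_iff]
      ring
    rw [Finset.sum_congr rfl h3, Finset.sum_comm]
    refine Finset.sum_congr rfl fun c _ => ?_
    rw [Finset.sum_comm]
    refine Finset.sum_congr rfl fun d _ => ?_
    rw [Finset.sum_filter, Finset.mul_sum]
    refine Finset.sum_congr rfl fun m _ => ?_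
    split_ifs <;> simp
  have h3 : ∑ c ∈ Finset.Icc 1 R, ∑ d ∈ Finset.Icc 1 R, lam c * lam d *
        ∑ m ∈ s.filter (Nat.lcm c d ∣ ·), a m ≤
      ∑ c ∈ Finset.Icc 1 R, ∑ d ∈ Finset.Icc 1 R,
        (X * (lam c * lam d / (Nat.lcm c d : ℝ)) + E) := by
    refine Finset.sum_le_sum fun c hc => Finset.sum_le_sum fun d hd => ?_
    rw [Finset.mem_Icc] at hc hd
    have hl : Nat.lcm c d ≤ R ^ 2 := by
      rw [sq]
      exact (Nat.le_of_dvd (Nat.mul_pos (by omega) (by omega)) (Nat.lcm_dvd_mul c d)).trans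
        (Nat.mul_le_mul hc.2 hd.2)
    have := hE _ (Nat.lcm_pos (by omega) (by omega)) hl
    have hlam1 : |lam c * lam d| ≤ 1 := by
      rw [abs_mul]
      exact mul_le_one₀ (abs_selbergWeight_le_one hR c) (abs_nonneg _)
        (abs_selbergWeight_le_one hR d)
    set T := ∑ m ∈ s.filter (Nat.lcm c d ∣ ·), a m
    have h4 : lam c * lam d * (T - X / (Nat.lcm c d : ℝ)) ≤ E := by
      refine (le_abs_self _).trans ?_
      rw [abs_mul]
      calc _ ≤ 1 * |T - X / (Nat.lcm c d : ℝ)| := by gcongr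
        _ ≤ E := by rw [one_mul]; exact this
    calc _ = X * (lam c * lam d / (Nat.lcm c d : ℝ)) +
          lam c * lam d * (T - X / (Nat.lcm c d : ℝ)) := by ring
      _ ≤ _ := by linarith
  have h4 : ∑ c ∈ Finset.Icc 1 R, ∑ d ∈ Finset.Icc 1 R,
        (X * (lam c * lam d / (Nat.lcm c d : ℝ)) + E) = X * (1 / selbergSum R) + R ^ 2 * E := by
    simp_rw [Finset.sum_add_distrib, ← Finset.mul_sum]
    rw [sum_selbergWeight_mul_div_lcm hR]
    simp; ring
  have hlog : 0 < Real.log ((R : ℝ) + 1) := Real.log_pos (by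
    have : (1 : ℝ) ≤ R := by exact_mod_cast hR
    linarith)
  have h5 : X * (1 / selbergSum R) ≤ X / Real.log (R + 1) := by
    rw [mul_one_div]
    have := log_le_selbergSum R
    gcongr
  linarith

/-! ### Primes dividing a short product, in dyadic ranges -/

/-- The sum of `e (k x / m)` over the multiples `m` of `d` in `(M, 2M]`, where `M = l H` and the
frequency `k` is at most `H`. The bound is uniform in `d ≤ R²` and in `k`. -/
theorem norm_sum_multiples_le {l H R d k : ℕ} {x E : ℝ} (hl : 1 ≤ l) (hx : 0 < x)
    (hd : 1 ≤ d) (hdR : d ≤ R ^ 2) (hk : 1 ≤ k) (hkH : k ≤ H) (hRM : R ^ 2 ≤ l * H)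
    (hM3 : 4 * H * x * (R : ℝ) ^ 4 ≤ ((l * H : ℕ) : ℝ) ^ 3) (hE : 0 ≤ E)
    (hE2 : 16 * x / l + (384 * ((l * H : ℕ) : ℝ) + 192 * (((l * H : ℕ) : ℝ) ^ 3 / x)) *
      (1 + Real.log (2 * ((l * H : ℕ) : ℝ))) ≤ E ^ 2) :
    ‖∑ m ∈ (Finset.Ioc (l * H) (2 * (l * H))).filter (d ∣ ·), e (k * (x / m))‖ ≤ E := by
  set M := l * H with hM
  have hMd : d ≤ M := hdR.trans hRM
  have hM1 : 1 ≤ M := hd.trans hMd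
  set A := M / d + 1 with hA
  set N := 2 * M / d - M / d with hN
  have hdiv : 2 * M / d ≤ 2 * (M / d) + 1 := by
    have h1 := Nat.div_add_mod M d
    have h2 := Nat.mod_lt M hd
    rw [← Nat.lt_succ_iff, Nat.div_lt_iff_lt_mul hd]
    have : Nat.succ (2 * (M / d) + 1) * d = 2 * (d * (M / d)) + 2 * d := by
      rw [Nat.succ_eq_add_one]; ring
    omega
  have hdiv' : M / d ≤ 2 * M / d := Nat.div_le_div_right (by omega)
  have hNA : N ≤ A := by omega
  have hd0 : (0 : ℝ) < d := by exact_mod_cast hd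
  have hl0 : (0 : ℝ) < l := by exact_mod_cast hl
  have hk0 : (0 : ℝ) < k := by exact_mod_cast hk
  have hkH' : (k : ℝ) ≤ H := by exact_mod_cast hkH
  have hM0 : (0 : ℝ) < M := by exact_mod_cast hM1
  have hd1 : (1 : ℝ) ≤ d := by exact_mod_cast hd
  have hk1 : (1 : ℝ) ≤ k := by exact_mod_cast hk
  set y : ℝ := k * x / d with hy
  have hy0 : 0 < y := by positivity
  have hsum : ∑ m ∈ (Finset.Ioc M (2 * M)).filter (d ∣ ·), e (k * (x / m)) =
      ∑ j ∈ Finset.range N, e (y / (A + (j : ℕ))) := by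
    symm
    refine Finset.sum_bij (fun j _ => d * (A + j)) ?_ ?_ ?_ ?_
    · intro j hj
      rw [Finset.mem_range] at hj
      rw [Finset.mem_filter, Finset.mem_Ioc]
      refine ⟨⟨?_, ?_⟩, dvd_mul_right _ _⟩
      · have := Nat.lt_mul_div_succ M (show 0 < d from hd)
        calc M < d * (M / d + 1) := this
          _ ≤ d * (A + j) := Nat.mul_le_mul_left _ (by omega)
      · calc d * (A + j) ≤ d * (2 * M / d) := Nat.mul_le_mul_left _ (by omega)
          _ ≤ 2 * M := Nat.mul_div_le _ _
    · intro a _ b _ hab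
      have := Nat.eq_of_mul_eq_mul_left hd hab
      omega
    · intro m hm
      rw [Finset.mem_filter, Finset.mem_Ioc] at hm
      obtain ⟨⟨hm1, hm2⟩, c, rfl⟩ := hm
      have hc1 : M / d < c := (Nat.div_lt_iff_lt_mul hd).2 (by rwa [mul_comm])
      have hc2 : c ≤ 2 * M / d := (Nat.le_div_iff_mul_le hd).2 (by rwa [mul_comm])
      exact ⟨c - A, Finset.mem_range.2 (by omega), by congr 1; omega⟩
    · intro j _
      congr 1
      rw [hy]
      push_cast
      have : (A : ℝ) + j ≠ 0 := by
        have : (1 : ℝ) ≤ A := by exact_mod_cast (by omega : 1 ≤ A)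
        positivity
      field_simp
  rw [hsum]
  have hA1 : (1 : ℝ) ≤ A := by exact_mod_cast (by omega : 1 ≤ A)
  have hA_low : (M : ℝ) / d ≤ A := by
    rw [div_le_iff₀ hd0]
    have := (Nat.lt_mul_div_succ M (show 0 < d from hd)).le
    rw [mul_comm] at this
    exact_mod_cast this
  have hA_up : (A : ℝ) ≤ 2 * M / d := by
    have h1 : ((M / d : ℕ) : ℝ) ≤ M / d := Nat.cast_div_le
    have h2 : (1 : ℝ) ≤ M / d := by
      rw [le_div_iff₀ hd0, one_mul]; exact_mod_cast hMd
    have h3 : (A : ℝ) = ((M / d : ℕ) : ℝ) + 1 := by rw [hA]; push_cast; rfl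
    rw [h3, mul_div_assoc]; linarith
  have hyA : 4 * y ≤ (A : ℝ) ^ 3 := by
    have h1 : (d : ℝ) ^ 2 ≤ (R : ℝ) ^ 4 := by
      have : (d : ℝ) ≤ (R : ℝ) ^ 2 := by exact_mod_cast hdR
      calc (d : ℝ) ^ 2 ≤ ((R : ℝ) ^ 2) ^ 2 := by gcongr
        _ = _ := by ring
    calc 4 * y = 4 * k * x * (d : ℝ) ^ 2 / (d : ℝ) ^ 3 := by rw [hy]; field_simp
      _ ≤ 4 * H * x * (R : ℝ) ^ 4 / (d : ℝ) ^ 3 := by gcongr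
      _ ≤ (M : ℝ) ^ 3 / (d : ℝ) ^ 3 := by gcongr
      _ = (M / d : ℝ) ^ 3 := by rw [div_pow]
      _ ≤ _ := by gcongr
  have h := norm_sum_e_div_sq_le (by omega : 1 ≤ A) hNA hy0 hyA
  have hMl : (M : ℝ) = l * H := by rw [hM]; push_cast; rfl
  have b1 : 16 * y / A ≤ 16 * x / l := by
    calc 16 * y / A ≤ 16 * y / (M / d) := by gcongr
      _ = 16 * x * k / (l * H) := by rw [hy, hMl]; field_simp
      _ ≤ 16 * x * H / (l * H) := by gcongr
      _ = 16 * x / l := by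
        have : (0 : ℝ) < H := hk0.trans_le hkH'
        field_simp
  have b2 : (A : ℝ) ≤ 2 * M := hA_up.trans (div_le_self (by positivity) hd1)
  have b3 : (A : ℝ) ^ 3 / y ≤ 8 * ((M : ℝ) ^ 3 / x) := by
    calc (A : ℝ) ^ 3 / y ≤ (2 * M / d) ^ 3 / y := by gcongr
      _ = 8 * ((M : ℝ) ^ 3 / x) / ((d : ℝ) ^ 2 * k) := by rw [hy]; field_simp; norm_num
      _ ≤ _ := div_le_self (by positivity) (one_le_mul_of_one_le_of_one_le (one_le_pow₀ hd1) hk1)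
  have b4 : Real.log A ≤ Real.log (2 * M) := Real.log_le_log (by linarith) b2
  have hlogA : 0 ≤ Real.log A := Real.log_nonneg hA1
  refine le_of_sq_le_sq ?_ hE
  refine h.trans (le_trans ?_ hE2)
  have : (192 * (A : ℝ) + 24 * ((A : ℝ) ^ 3 / y)) * (1 + Real.log A) ≤
      (384 * (M : ℝ) + 192 * ((M : ℝ) ^ 3 / x)) * (1 + Real.log (2 * M)) := by
    gcongr ?_ * (1 + ?_)
    linarith
  linarith

/-- The number of primes in `(l H, 2 l H]` that divide one of `n + 1, …, n + l`. Such a prime `p`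
has `(n + l / 2) / p` within `1 / (2 H)` of an integer, which is detected by a Fejér kernel of
length `H`; primality is detected by the Selberg sieve. -/
theorem card_prime_dvd_dyadic_le {n l H R : ℕ} {x E : ℝ} (hxn : x = n + l / 2) (hl : 1 ≤ l)
    (hH : 1 ≤ H) (hR : 1 ≤ R) (hRM : R ^ 2 ≤ l * H)
    (hM3 : 4 * H * x * (R : ℝ) ^ 4 ≤ ((l * H : ℕ) : ℝ) ^ 3) (hE : 0 ≤ E)
    (hE2 : 16 * x / l + (384 * ((l * H : ℕ) : ℝ) + 192 * (((l * H : ℕ) : ℝ) ^ 3 / x)) *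
      (1 + Real.log (2 * ((l * H : ℕ) : ℝ))) ≤ E ^ 2) :
    ((((Finset.Ioc (l * H) (2 * (l * H))).filter Nat.Prime).filter
      (fun p => ∃ i ∈ Finset.Icc 1 l, p ∣ n + i)).card : ℝ) ≤
      Real.pi ^ 2 / 4 * (l / Real.log (R + 1) + R ^ 2 * (1 + 2 * E)) := by
  set M := l * H with hM
  have hH0 : (0 : ℝ) < H := by exact_mod_cast hH
  have hH1 : (1 : ℝ) ≤ H := by exact_mod_cast hH
  have hl0 : (0 : ℝ) < l := by exact_mod_cast hl
  have hx : 0 < x := by rw [hxn]; positivity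
  have hMl : (M : ℝ) = l * H := by rw [hM]; push_cast; rfl
  -- This factor normalizes the Fejér kernel to be at least `1` within `1 / (2H)` of an integer.
  set c : ℝ := Real.pi ^ 2 / (4 * (H : ℝ) ^ 2) with hc
  have hc0 : 0 < c := by positivity
  set z : ℕ → ℕ → ℂ := fun h m => e (h * (x / m)) with hz
  set a : ℕ → ℝ := fun m => c * ‖∑ h ∈ Finset.range H, z h m‖ ^ 2 with ha
  have hhit : ∀ p ∈ ((Finset.Ioc M (2 * M)).filter Nat.Prime).filter
      (fun p => ∃ i ∈ Finset.Icc 1 l, p ∣ n + i), 1 ≤ a p := by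
    intro p hp
    rw [Finset.mem_filter, Finset.mem_filter, Finset.mem_Ioc] at hp
    obtain ⟨⟨⟨hp1, _⟩, _⟩, i, hi, q, hq⟩ := hp
    rw [Finset.mem_Icc] at hi
    have hp0 : (0 : ℝ) < p := by exact_mod_cast (by omega : 0 < p)
    have hMp : (M : ℝ) ≤ p := by exact_mod_cast hp1.le
    have hq' : (n : ℝ) + i = p * q := by exact_mod_cast hq
    have hi1 : (1 : ℝ) ≤ i := by exact_mod_cast hi.1
    have hi2 : (i : ℝ) ≤ l := by exact_mod_cast hi.2
    have hnear : |x / p - (q : ℤ)| ≤ 1 / (2 * H) := by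
      have h1 : x / p - ((q : ℤ) : ℝ) = (l / 2 - i) / p := by
        push_cast
        rw [hxn]; field_simp; linarith
      rw [h1, abs_div, abs_of_pos hp0]
      calc |(l : ℝ) / 2 - i| / p ≤ (l / 2) / M := by
            have : |(l : ℝ) / 2 - i| ≤ l / 2 := by rw [abs_le]; constructor <;> linarith
            have hM0 : (0 : ℝ) < M := by rw [hMl]; positivity
            gcongr
        _ = 1 / (2 * H) := by rw [hMl]; field_simp
    have h2 := four_mul_sq_div_pi_sq_le_fejer hH hnear
    calc (1 : ℝ) = c * (4 * (H : ℝ) ^ 2 / Real.pi ^ 2) := by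
          have := Real.pi_pos
          rw [hc]; field_simp
      _ ≤ a p := by simp only [ha, hz]; gcongr
  have hcard : ((((Finset.Ioc M (2 * M)).filter Nat.Prime).filter
      (fun p => ∃ i ∈ Finset.Icc 1 l, p ∣ n + i)).card : ℝ) ≤
      ∑ p ∈ (Finset.Ioc M (2 * M)).filter Nat.Prime, a p := by
    rw [Finset.card_eq_sum_ones, Nat.cast_sum, Nat.cast_one]
    refine (Finset.sum_le_sum hhit).trans ?_
    exact Finset.sum_le_sum_of_subset_of_nonneg (Finset.filter_subset _ _)
      fun m _ _ => by simp only [ha]; positivity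
  refine hcard.trans ?_
  have hsieve := sum_prime_le_of_equidistributed (Finset.Ioc M (2 * M)) a
    (fun m => by simp only [ha]; positivity) hR (X := Real.pi ^ 2 / 4 * l)
    (E := Real.pi ^ 2 / 4 * (1 + 2 * E)) ?_ (by positivity) ?_
  · refine hsieve.trans (le_of_eq ?_); ring
  · intro m hm
    rw [Finset.mem_Ioc] at hm
    have : R ≤ R ^ 2 := Nat.le_self_pow two_ne_zero R
    omega
  · intro d hd hdR
    set s := (Finset.Ioc M (2 * M)).filter (d ∣ ·) with hs
    have hd0 : (0 : ℝ) < d := by exact_mod_cast hd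
    have hexp := abs_sum_norm_sq_sub_diag_le s H z
    have hdiag : ∑ h ∈ Finset.range H, ∑ m ∈ s, ‖z h m‖ ^ 2 = H * s.card := by
      simp only [hz, norm_e]; simp
    have hoff : ∑ h ∈ Finset.range H, ∑ h' ∈ Finset.range h,
        ‖∑ m ∈ s, z h m * (starRingEnd ℂ) (z h' m)‖ ≤ (H : ℝ) ^ 2 * E := by
      have : ∀ h ∈ Finset.range H, ∑ h' ∈ Finset.range h,
          ‖∑ m ∈ s, z h m * (starRingEnd ℂ) (z h' m)‖ ≤ H * E := by
        intro h hh
        rw [Finset.mem_range] at hh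
        have h1 : ∀ h' ∈ Finset.range h,
            ‖∑ m ∈ s, z h m * (starRingEnd ℂ) (z h' m)‖ ≤ E := by
          intro h' hh'
          rw [Finset.mem_range] at hh'
          have h2 := norm_sum_multiples_le (k := h - h') hl hx hd hdR (by omega) (by omega : _ ≤ H)
            hRM hM3 hE hE2
          refine le_trans (le_of_eq ?_) h2
          congr 1
          refine Finset.sum_congr rfl fun m _ => ?_
          simp only [hz]
          rw [e_mul_conj_e, Nat.cast_sub hh'.le]
          congr 1; ring
        refine (Finset.sum_le_sum h1).trans ?_
        rw [Finset.sum_const, Finset.card_range, nsmul_eq_mul]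
        gcongr
      refine (Finset.sum_le_sum this).trans (le_of_eq ?_)
      rw [Finset.sum_const, Finset.card_range, nsmul_eq_mul]; ring
    rw [hdiag] at hexp
    have hcount : |(s.card : ℝ) - M / d| ≤ 1 := by
      have h1 : s.card = 2 * M / d - M / d := by
        have h0 : s = (Finset.Ioc (M / d) (2 * M / d)).image (d * ·) := by
          ext m
          simp only [hs, Finset.mem_filter, Finset.mem_Ioc, Finset.mem_image]
          constructor
          · rintro ⟨⟨h1, h2⟩, q, rfl⟩
            exact ⟨q, ⟨(Nat.div_lt_iff_lt_mul hd).2 (by rwa [mul_comm]),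
              (Nat.le_div_iff_mul_le hd).2 (by rwa [mul_comm])⟩, rfl⟩
          · rintro ⟨q, ⟨h1, h2⟩, rfl⟩
            rw [Nat.div_lt_iff_lt_mul hd] at h1
            rw [Nat.le_div_iff_mul_le hd] at h2
            exact ⟨⟨by rwa [mul_comm], by rwa [mul_comm]⟩, dvd_mul_right _ _⟩
        rw [h0, Finset.card_image_of_injective _ fun a b h => Nat.eq_of_mul_eq_mul_left hd h,
          Nat.card_Ioc]
      have h2 : M / d ≤ 2 * M / d := Nat.div_le_div_right (by omega)
      rw [h1, Nat.cast_sub h2]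
      have e1 : ((2 * M / d : ℕ) : ℝ) ≤ 2 * M / d := by
        refine Nat.cast_div_le.trans (le_of_eq ?_); push_cast; rfl
      have e2 : ((M / d : ℕ) : ℝ) ≤ M / d := Nat.cast_div_le
      have e3 : 2 * (M : ℝ) / d < ((2 * M / d : ℕ) : ℝ) + 1 := by
        rw [div_lt_iff₀ hd0]
        have := Nat.lt_mul_div_succ (2 * M) (show 0 < d from hd)
        rw [mul_comm d] at this
        exact_mod_cast this
      have e4 : (M : ℝ) / d < ((M / d : ℕ) : ℝ) + 1 := by
        rw [div_lt_iff₀ hd0]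
        have := Nat.lt_mul_div_succ M (show 0 < d from hd)
        rw [mul_comm] at this
        exact_mod_cast this
      rw [mul_div_assoc] at e1 e3
      rw [abs_le]; constructor <;> linarith
    have hsum : ∑ m ∈ s, a m - Real.pi ^ 2 / 4 * l / d =
        c * (∑ m ∈ s, ‖∑ h ∈ Finset.range H, z h m‖ ^ 2 - H * s.card) +
          c * (H * (s.card - M / d)) := by
      simp only [ha]
      rw [← Finset.mul_sum, hMl, hc]; field_simp; ring
    rw [hsum]
    refine (abs_add_le _ _).trans ?_
    rw [abs_mul, abs_mul, abs_mul, abs_of_pos hc0, abs_of_pos hH0]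
    calc _ ≤ c * (2 * ((H : ℝ) ^ 2 * E)) + c * (H * 1) := by
          gcongr
          exact hexp.trans (by gcongr)
      _ ≤ c * (2 * ((H : ℝ) ^ 2 * E)) + c * (H * H) := by gcongr
      _ = _ := by rw [hc]; field_simp; ring

/-- Primes in `(l, 2^J l]` that divide one of `n + 1, …, n + l`, counted dyadically. -/
theorem card_prime_dvd_le {n l J R : ℕ} {x Q E : ℝ} (hxn : x = n + l / 2) (hl : 1 ≤ l)
    (hR : 1 ≤ R) (hRl : R ^ 2 ≤ l) (hl3 : 4 * x * (R : ℝ) ^ 4 ≤ (l : ℝ) ^ 3)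
    (hQ : ∀ j < J, (2 : ℝ) ^ j ≤ Q) (hE : 0 ≤ E)
    (hE2 : 16 * x / l + (384 * (l * Q) + 192 * ((l * Q) ^ 3 / x)) *
      (1 + Real.log (2 * (l * Q))) ≤ E ^ 2) :
    ((((Finset.Ioc l (2 ^ J * l)).filter Nat.Prime).filter
      (fun p => ∃ i ∈ Finset.Icc 1 l, p ∣ n + i)).card : ℝ) ≤
      J * (Real.pi ^ 2 / 4 * (l / Real.log (R + 1) + R ^ 2 * (1 + 2 * E))) := by
  have hl0 : (1 : ℝ) ≤ l := by exact_mod_cast hl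
  have hx : 0 < x := by rw [hxn]; positivity
  induction J with
  | zero => simp
  | succ J ih =>
    have ih' := ih fun j hj => hQ j (by omega)
    have hHQ := hQ J (by omega)
    have hH1 : (1 : ℝ) ≤ 2 ^ J := one_le_pow₀ (by norm_num)
    have h := card_prime_dvd_dyadic_le (H := 2 ^ J) hxn hl Nat.one_le_two_pow hR
      (hRl.trans (Nat.le_mul_of_pos_right l (by positivity))) ?_ hE ?_
    · have hsub : ((Finset.Ioc l (2 ^ (J + 1) * l)).filter Nat.Prime).filter
          (fun p => ∃ i ∈ Finset.Icc 1 l, p ∣ n + i) ⊆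
          (((Finset.Ioc l (2 ^ J * l)).filter Nat.Prime).filter
            (fun p => ∃ i ∈ Finset.Icc 1 l, p ∣ n + i)) ∪
          (((Finset.Ioc (l * 2 ^ J) (2 * (l * 2 ^ J))).filter Nat.Prime).filter
            (fun p => ∃ i ∈ Finset.Icc 1 l, p ∣ n + i)) := by
        intro p hp
        simp only [Finset.mem_union, Finset.mem_filter, Finset.mem_Ioc] at hp ⊢
        obtain ⟨⟨⟨h1, h2⟩, h3⟩, h4⟩ := hp
        have e1 : 2 * (l * 2 ^ J) = 2 ^ (J + 1) * l := by ring
        have e2 : l * 2 ^ J = 2 ^ J * l := by ring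
        rw [e1, e2]
        rcases le_or_gt p (2 ^ J * l) with h5 | h5
        · exact Or.inl ⟨⟨⟨h1, h5⟩, h3⟩, h4⟩
        · exact Or.inr ⟨⟨⟨h5, h2⟩, h3⟩, h4⟩
      have hc := (Finset.card_le_card hsub).trans (Finset.card_union_le _ _)
      have hc' : ((((Finset.Ioc l (2 ^ (J + 1) * l)).filter Nat.Prime).filter
          (fun p => ∃ i ∈ Finset.Icc 1 l, p ∣ n + i)).card : ℝ) ≤ _ := Nat.cast_le.2 hc
      rw [Nat.cast_add] at hc'
      refine hc'.trans ((add_le_add ih' h).trans (le_of_eq ?_))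
      push_cast; ring
    · push_cast
      calc 4 * (2 : ℝ) ^ J * x * (R : ℝ) ^ 4 = 4 * x * (R : ℝ) ^ 4 * 2 ^ J := by ring
        _ ≤ (l : ℝ) ^ 3 * (2 ^ J) ^ 3 := by
          gcongr
          exact le_self_pow₀ hH1 (by norm_num)
        _ = _ := by ring
    · refine le_trans ?_ hE2
      push_cast
      have : 0 ≤ Real.log (2 * ((l : ℝ) * 2 ^ J)) := Real.log_nonneg (by nlinarith)
      have : (0 : ℝ) < Q := by linarith
      have : 0 ≤ 384 * (↑l * Q) + 192 * ((↑l * Q) ^ 3 / x) := by positivity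
      gcongr

/-! ### The size of the prime factors of a short product -/

/-- If `(n + 1) ⋯ (n + l)` has at least `l` prime factors, the primes among them that exceed `l`
multiply to at most `C(n + l, l)`, so that only few of them can be much larger than `l`. -/
theorem log_count_le_of_le_card_primeFactors {n l : ℕ} (hl : 1 ≤ l) {Y t : ℝ} (ht : 0 ≤ t)
    (hω : l ≤ (∏ i ∈ Finset.Icc 1 l, (n + i)).primeFactors.card) {K : ℕ}
    (hK : Real.log l + t ≤ Real.log K) (hK0 : 1 ≤ K)
    (hY : ((((Finset.Ioc l K).filter Nat.Prime).filter
      (fun p => ∃ i ∈ Finset.Icc 1 l, p ∣ n + i)).card : ℝ) ≤ Y) :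
    (l - Nat.primeCounting l) * Real.log l + (l - Nat.primeCounting l - Y) * t ≤
      l * (Real.log (n + l) - Real.log l + 1) := by
  set W := ∏ i ∈ Finset.Icc 1 l, (n + i) with hW
  have hl0 : (0 : ℝ) < l := by exact_mod_cast hl
  have hlogl : 0 ≤ Real.log l := Real.log_natCast_nonneg l
  set P := W.primeFactors.filter (l < ·) with hP
  set Ps := P.filter (· ≤ K) with hPs
  set Pb := P.filter (¬ · ≤ K) with hPb
  have hcardP : (l : ℝ) - Nat.primeCounting l ≤ P.card := by
    have h1 : (W.primeFactors.filter (¬ l < ·)).card ≤ Nat.primeCounting l := by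
      rw [← Nat.primesLE_card_eq_primeCounting]
      refine Finset.card_le_card fun p hp => ?_
      rw [Finset.mem_filter] at hp
      rw [Nat.mem_primesLE]
      exact ⟨by omega, Nat.prime_of_mem_primeFactors hp.1⟩
    have h2 := Finset.card_filter_add_card_filter_not (s := W.primeFactors) (l < ·)
    have h3 : l ≤ P.card + Nat.primeCounting l := by rw [← hP] at h2; omega
    have h4 : (l : ℝ) ≤ P.card + Nat.primeCounting l := by exact_mod_cast h3
    linarith
  have hcardPs : (Ps.card : ℝ) ≤ Y := by
    refine le_trans ?_ hY
    refine Nat.cast_le.2 (Finset.card_le_card fun p hp => ?_)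
    simp only [hPs, hP, Finset.mem_filter] at hp
    obtain ⟨⟨hpW, hlp⟩, hpK⟩ := hp
    have hpp := Nat.prime_of_mem_primeFactors hpW
    obtain ⟨i, hi, hd⟩ := (hpp.prime.dvd_finsetProd_iff _).1 (Nat.dvd_of_mem_primeFactors hpW)
    simp only [Finset.mem_filter, Finset.mem_Ioc]
    exact ⟨⟨⟨hlp, hpK⟩, hpp⟩, i, hi, hd⟩
  have hsplit : (Ps.card : ℝ) + Pb.card = P.card := by
    exact_mod_cast Finset.card_filter_add_card_filter_not (s := P) (· ≤ K)
  have hlower : P.card * Real.log l + Pb.card * t ≤ ∑ p ∈ P, Real.log p := by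
    have h1 : ∑ p ∈ P, Real.log p = ∑ p ∈ Ps, Real.log p + ∑ p ∈ Pb, Real.log p :=
      (Finset.sum_filter_add_sum_filter_not P (· ≤ K) _).symm
    have h2 : Ps.card * Real.log l ≤ ∑ p ∈ Ps, Real.log p := by
      rw [← nsmul_eq_mul]
      refine Finset.card_nsmul_le_sum _ _ _ fun p hp => ?_
      simp only [hPs, hP, Finset.mem_filter] at hp
      exact Real.log_le_log hl0 (by exact_mod_cast hp.1.2.le)
    have h3 : Pb.card * (Real.log l + t) ≤ ∑ p ∈ Pb, Real.log p := by
      rw [← nsmul_eq_mul]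
      refine Finset.card_nsmul_le_sum _ _ _ fun p hp => ?_
      simp only [hPb, hP, Finset.mem_filter] at hp
      refine hK.trans (Real.log_le_log (by exact_mod_cast hK0) ?_)
      exact_mod_cast (by omega : K ≤ p)
    rw [h1, ← hsplit]
    linarith
  have hfact : W = l.factorial * (n + l).choose l := by
    rw [hW, ← Nat.ascFactorial_eq_factorial_mul_choose, Nat.ascFactorial_eq_prod_range,
      ← Finset.Ico_add_one_right_eq_Icc, Finset.prod_Ico_eq_prod_range, Nat.add_sub_cancel]
    exact Finset.prod_congr rfl fun i _ => by ring
  have hdvd : ∏ p ∈ P, p ∣ (n + l).choose l := by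
    refine Finset.prod_primes_dvd _ (fun p hp => ?_) fun p hp => ?_
    · simp only [hP, Finset.mem_filter] at hp
      exact (Nat.prime_of_mem_primeFactors hp.1).prime
    · simp only [hP, Finset.mem_filter] at hp
      have hpp := Nat.prime_of_mem_primeFactors hp.1
      have hd := Nat.dvd_of_mem_primeFactors hp.1
      rw [hfact, hpp.dvd_mul] at hd
      rcases hd with h | h
      · have := (hpp.dvd_factorial).1 h
        omega
      · exact h
  have hupper : ∑ p ∈ P, Real.log p ≤ l * (Real.log (n + l) - Real.log l + 1) := by
    have hch : 0 < (n + l).choose l := Nat.choose_pos (by omega)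
    have h1 : ∑ p ∈ P, Real.log p ≤ Real.log ((n + l).choose l) := by
      rw [← Real.log_prod]
      · refine Real.log_le_log (Finset.prod_pos fun p hp => ?_) ?_
        · simp only [hP, Finset.mem_filter] at hp
          exact_mod_cast (Nat.prime_of_mem_primeFactors hp.1).pos
        · have := Nat.le_of_dvd hch hdvd
          rw [← Nat.cast_prod]
          exact_mod_cast this
      · intro p hp
        simp only [hP, Finset.mem_filter] at hp
        exact_mod_cast (Nat.prime_of_mem_primeFactors hp.1).ne_zero
    have h2 : ((n + l).choose l : ℝ) ≤ ((n + l : ℕ) : ℝ) ^ l / l.factorial :=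
      Nat.choose_le_pow_div l (n + l)
    have h3 : (l : ℝ) ^ l / l.factorial ≤ Real.exp l := Real.pow_div_factorial_le_exp l hl0.le l
    have hf : (0 : ℝ) < l.factorial := by exact_mod_cast l.factorial_pos
    have h4 : ((n + l).choose l : ℝ) ≤ ((n + l : ℝ) / l) ^ l * Real.exp l := by
      refine h2.trans ?_
      push_cast
      calc ((n : ℝ) + l) ^ l / l.factorial =
          ((n + l : ℝ) / l) ^ l * ((l : ℝ) ^ l / l.factorial) := by
            rw [div_pow]; field_simp
        _ ≤ _ := by gcongr
    refine h1.trans ((Real.log_le_log (by exact_mod_cast hch) h4).trans (le_of_eq ?_))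
    rw [Real.log_mul (by positivity) (by positivity), Real.log_exp, Real.log_pow,
      Real.log_div (by positivity) (by positivity)]
    ring
  have hb : (l : ℝ) - Nat.primeCounting l - Y ≤ Pb.card := by linarith
  calc _ ≤ P.card * Real.log l + Pb.card * t := by gcongr
    _ ≤ _ := hlower.trans hupper

/-! ### Asymptotics -/

theorem eventually_mul_rpow_mul_log_le (C : ℝ) {a b : ℝ} (hab : a < b) :
    ∀ᶠ n : ℕ in atTop, C * (n : ℝ) ^ a * (1 + Real.log n) ≤ (n : ℝ) ^ b := by
  have h1 := (isLittleO_log_rpow_atTop (sub_pos.2 hab)).bound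
    (show (0 : ℝ) < 1 / (2 * (|C| + 1)) by positivity)
  have h2 := tendsto_natCast_atTop_atTop (R := ℝ)
  filter_upwards [h2.eventually h1, h2.eventually (Real.tendsto_log_atTop.eventually_ge_atTop 1),
    h2.eventually_ge_atTop 1] with n hn hlog hn1
  rw [Real.norm_of_nonneg (by linarith), Real.norm_of_nonneg (by positivity), div_mul_eq_mul_div,
    one_mul, le_div_iff₀ (by positivity)] at hn
  have hb : (n : ℝ) ^ b = (n : ℝ) ^ a * (n : ℝ) ^ (b - a) := by
    rw [← Real.rpow_add (by linarith)]; congr 1; ring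
  rw [hb]
  calc C * (n : ℝ) ^ a * (1 + Real.log n) ≤ (|C| + 1) * (n : ℝ) ^ a * (2 * Real.log n) := by
        gcongr
        · exact (le_abs_self C).trans (by linarith)
        · linarith
    _ = (n : ℝ) ^ a * (Real.log n * (2 * (|C| + 1))) := by ring
    _ ≤ _ := by gcongr

theorem eventually_primeCounting_le_mul {ε : ℝ} (hε : 0 < ε) :
    ∀ᶠ l : ℕ in atTop, (Nat.primeCounting l : ℝ) ≤ ε * l := by
  have h1 := Chebyshev.eventually_primeCounting_le one_pos
  have h2 := tendsto_natCast_atTop_atTop (R := ℝ)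
  filter_upwards [h2.eventually h1, h2.eventually
    (Real.tendsto_log_atTop.eventually_ge_atTop ((Real.log 4 + 1) / ε)),
    h2.eventually (Real.tendsto_log_atTop.eventually_ge_atTop 1)] with l hl hlog hlog1
  rw [Nat.floor_natCast] at hl
  refine hl.trans ?_
  rw [div_le_iff₀ hε] at hlog
  rw [div_le_iff₀ (by linarith)]
  calc (Real.log 4 + 1) * (l : ℝ) ≤ Real.log l * ε * l := by gcongr
    _ = _ := by ring

/-- The numerical constants of the sieve bound over all dyadic ranges:
`π² / 4 · 10 / (64 log 2) < 3 / 5`. -/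
theorem dyadic_total_le {l lam J u v : ℝ} (hl : 0 ≤ l) (hlam : 10000 ≤ lam)
    (hJ : J ≤ lam / (64 * Real.log 2) + 1) (hu : u ≤ 10 * (l / lam)) (hv : v ≤ 1 / 10 * (l / lam))
    (hu0 : 0 ≤ u) (hv0 : 0 ≤ v) :
    J * (Real.pi ^ 2 / 4 * (u + v)) ≤ 3 / 5 * l := by
  have hlam0 : 0 < lam := by linarith
  have hpi : Real.pi ^ 2 / 4 ≤ 2.4675 := by
    have h1 := Real.pi_lt_d4
    have h2 := Real.pi_pos
    nlinarith
  have hlog2 := Real.log_two_gt_d9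
  have hJ' : J ≤ lam * 0.02265 := by
    have h1 : lam / (64 * Real.log 2) ≤ lam * 0.02255 := by
      rw [div_le_iff₀ (by positivity)]
      nlinarith
    linarith
  have h1 : Real.pi ^ 2 / 4 * (u + v) ≤ 2.4675 * (10.1 * (l / lam)) := by
    have : u + v ≤ 10.1 * (l / lam) := by linarith
    gcongr
  calc J * (Real.pi ^ 2 / 4 * (u + v)) ≤ lam * 0.02265 * (2.4675 * (10.1 * (l / lam))) := by
        gcongr
    _ = 0.02265 * 2.4675 * 10.1 * l := by field_simp
    _ ≤ _ := by nlinarith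

/-- For `l` about `n ^ (1/2 - 1/390)`, at most three fifths of `l` primes between `l` and
`l n ^ (1/64)` divide one of `n + 1, …, n + l`. -/
theorem eventually_card_prime_dvd_le : ∀ᶠ n : ℕ in atTop, ∀ l : ℕ,
    (n : ℝ) ^ (97 / 195 : ℝ) ≤ l → (l : ℝ) ≤ 2 * (n : ℝ) ^ (97 / 195 : ℝ) →
    ((((Finset.Ioc l (2 ^ ⌈Real.log n / (64 * Real.log 2)⌉₊ * l)).filter Nat.Prime).filter
      (fun p => ∃ i ∈ Finset.Icc 1 l, p ∣ n + i)).card : ℝ) ≤ 3 / 5 * l := by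
  have h2 := tendsto_natCast_atTop_atTop (R := ℝ)
  filter_upwards [h2.eventually (Real.tendsto_log_atTop.eventually_ge_atTop 10000),
    eventually_ge_atTop 2,
    eventually_mul_rpow_mul_log_le 2 (show (97 / 195 : ℝ) < 1 / 2 by norm_num),
    eventually_mul_rpow_mul_log_le 8 (show (7 / 5 : ℝ) < 97 / 65 by norm_num),
    eventually_mul_rpow_mul_log_le 1000 (show (35 / 64 : ℝ) < 9 / 16 by norm_num),
    eventually_mul_rpow_mul_log_le 2 (show (33 / 64 : ℝ) < 1 by norm_num),
    eventually_mul_rpow_mul_log_le 30 (show (77 / 160 : ℝ) < 97 / 195 by norm_num)]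
    with n hlog hn2 f1 f2 f3 f4 f5 l hl_low hl_up
  set lam := Real.log n with hlam
  have hn1 : (1 : ℝ) ≤ n := by exact_mod_cast (by omega : 1 ≤ n)
  have hn0 : (0 : ℝ) < n := by linarith
  have hpow : ∀ a : ℝ, 0 < (n : ℝ) ^ a := fun a => Real.rpow_pos_of_pos hn0 a
  have drop : ∀ C a b : ℝ, 0 ≤ C → C * (n : ℝ) ^ a * (1 + lam) ≤ (n : ℝ) ^ b →
      C * (n : ℝ) ^ a ≤ (n : ℝ) ^ b := by
    intro C a b hC h
    refine le_trans (le_mul_of_one_le_right (mul_nonneg hC (hpow a).le) (by linarith)) h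
  have hl1' : (1 : ℝ) ≤ l := (Real.one_le_rpow hn1 (by norm_num)).trans hl_low
  have hl1 : 1 ≤ l := by exact_mod_cast hl1'
  have hl_half : (l : ℝ) ≤ (n : ℝ) ^ (1 / 2 : ℝ) := hl_up.trans (drop _ _ _ (by norm_num) f1)
  have hln : (l : ℝ) ≤ n := hl_half.trans (by
    conv_rhs => rw [← Real.rpow_one (n : ℝ)]
    exact Real.rpow_le_rpow_of_exponent_le hn1 (by norm_num))
  -- The exponential sums are at most `n ^ (9/32)`, so that the error term `R ^ 2 n ^ (9/32)` of the
  -- sieve stays below `n ^ (77/160)`, a power of `n` less than `l`.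
  set R := ⌊(n : ℝ) ^ (1 / 10 : ℝ)⌋₊ with hRdef
  have hR1 : 1 ≤ R := by
    rw [hRdef, Nat.one_le_floor_iff]; exact Real.one_le_rpow hn1 (by norm_num)
  have hRle : (R : ℝ) ≤ (n : ℝ) ^ (1 / 10 : ℝ) := Nat.floor_le (hpow _).le
  have hRlog : lam / 10 ≤ Real.log (R + 1) := by
    have h := (Nat.lt_floor_add_one ((n : ℝ) ^ (1 / 10 : ℝ))).le
    have := Real.log_le_log (hpow _) h
    rw [Real.log_rpow hn0] at this
    linarith
  have hR2 : (R : ℝ) ^ 2 ≤ (n : ℝ) ^ (1 / 5 : ℝ) := by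
    calc (R : ℝ) ^ 2 ≤ ((n : ℝ) ^ (1 / 10 : ℝ)) ^ 2 := by gcongr
      _ = _ := by rw [← Real.rpow_mul_natCast hn0.le]; norm_num
  have hR4 : (R : ℝ) ^ 4 ≤ (n : ℝ) ^ (2 / 5 : ℝ) := by
    calc (R : ℝ) ^ 4 ≤ ((n : ℝ) ^ (1 / 10 : ℝ)) ^ 4 := by gcongr
      _ = _ := by rw [← Real.rpow_mul_natCast hn0.le]; norm_num
  have hRl : R ^ 2 ≤ l := by
    have : (R : ℝ) ^ 2 ≤ l := hR2.trans (le_trans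
      (Real.rpow_le_rpow_of_exponent_le hn1 (by norm_num)) hl_low)
    exact_mod_cast this
  set x : ℝ := n + l / 2 with hx
  have hxn : (n : ℝ) ≤ x := by rw [hx]; linarith
  have hx2 : x ≤ 2 * n := by rw [hx]; linarith
  set Q : ℝ := (n : ℝ) ^ (1 / 64 : ℝ) with hQ
  have hQ0 : 0 < Q := hpow _
  set E : ℝ := (n : ℝ) ^ (9 / 32 : ℝ) with hE
  have hE1 : 1 ≤ E := Real.one_le_rpow hn1 (by norm_num)
  set J := ⌈lam / (64 * Real.log 2)⌉₊ with hJ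
  have hlog2 := Real.log_two_gt_d9
  have hQJ : ∀ j < J, (2 : ℝ) ^ j ≤ Q := by
    intro j hj
    rw [hJ, Nat.lt_ceil, lt_div_iff₀ (by positivity)] at hj
    rw [← Real.log_le_log_iff (by positivity) hQ0, Real.log_pow, hQ, Real.log_rpow hn0]
    linarith
  have hlQ : (l : ℝ) * Q ≤ (n : ℝ) ^ (33 / 64 : ℝ) := by
    calc (l : ℝ) * Q ≤ (n : ℝ) ^ (1 / 2 : ℝ) * Q := by gcongr
      _ = _ := by rw [hQ, ← Real.rpow_add hn0]; norm_num
  have hl3 : 4 * x * (R : ℝ) ^ 4 ≤ (l : ℝ) ^ 3 := by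
    calc 4 * x * (R : ℝ) ^ 4 ≤ 4 * (2 * n) * (n : ℝ) ^ (2 / 5 : ℝ) := by gcongr
      _ = 8 * (n : ℝ) ^ (7 / 5 : ℝ) := by
        rw [show (7 / 5 : ℝ) = 1 + 2 / 5 by norm_num, Real.rpow_add hn0, Real.rpow_one]; ring
      _ ≤ (n : ℝ) ^ (97 / 65 : ℝ) := drop _ _ _ (by norm_num) f2
      _ = ((n : ℝ) ^ (97 / 195 : ℝ)) ^ 3 := by
        rw [← Real.rpow_mul_natCast hn0.le]; norm_num
      _ ≤ _ := by gcongr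
  have hE2 : 16 * x / l + (384 * (l * Q) + 192 * ((l * Q) ^ 3 / x)) *
      (1 + Real.log (2 * (l * Q))) ≤ E ^ 2 := by
    have e1 : 16 * x / l ≤ 32 * (n : ℝ) ^ (35 / 64 : ℝ) := by
      calc 16 * x / l ≤ 16 * (2 * n) / (n : ℝ) ^ (97 / 195 : ℝ) := by gcongr
        _ = 32 * (n : ℝ) ^ (98 / 195 : ℝ) := by
          rw [show (98 / 195 : ℝ) = 1 - 97 / 195 by norm_num, Real.rpow_sub hn0, Real.rpow_one]
          ring
        _ ≤ _ := by
          gcongr 32 * ?_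
          exact Real.rpow_le_rpow_of_exponent_le hn1 (by norm_num)
    have e2 : (l : ℝ) * Q ≤ (n : ℝ) ^ (35 / 64 : ℝ) :=
      hlQ.trans (Real.rpow_le_rpow_of_exponent_le hn1 (by norm_num))
    have e3 : ((l : ℝ) * Q) ^ 3 / x ≤ (n : ℝ) ^ (35 / 64 : ℝ) := by
      calc ((l : ℝ) * Q) ^ 3 / x ≤ ((n : ℝ) ^ (33 / 64 : ℝ)) ^ 3 / n := by gcongr
        _ = (n : ℝ) ^ (99 / 64 - 1 : ℝ) := by
          rw [← Real.rpow_mul_natCast hn0.le, Real.rpow_sub hn0, Real.rpow_one]; norm_num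
        _ = _ := by norm_num
    have e4 : Real.log (2 * (l * Q)) ≤ lam := by
      refine Real.log_le_log (by positivity) ?_
      calc 2 * (l * Q) ≤ 2 * (n : ℝ) ^ (33 / 64 : ℝ) := by gcongr
        _ ≤ (n : ℝ) ^ (1 : ℝ) := drop _ _ _ (by norm_num) f4
        _ = n := Real.rpow_one _
    have e5 : E ^ 2 = (n : ℝ) ^ (9 / 16 : ℝ) := by
      rw [hE, ← Real.rpow_mul_natCast hn0.le]; norm_num
    rw [e5]
    refine le_trans ?_ f3
    set V := (n : ℝ) ^ (35 / 64 : ℝ) with hV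
    have hV0 : 0 < V := hpow _
    have e6 : 384 * (l * Q) + 192 * ((l * Q) ^ 3 / x) ≤ 384 * V + 192 * V := by gcongr
    have e7 : 0 ≤ 384 * (l * Q) + 192 * ((l * Q) ^ 3 / x) := by positivity
    calc _ ≤ 32 * V + (384 * V + 192 * V) * (1 + lam) :=
          add_le_add e1 ((mul_le_mul_of_nonneg_left (by linarith) e7).trans
            (mul_le_mul_of_nonneg_right e6 (by linarith)))
      _ ≤ 1000 * V * (1 + lam) := by
        have e8 : 32 * V ≤ 32 * V * (1 + lam) :=
          le_mul_of_one_le_right (by positivity) (by linarith)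
        have e9 : 0 ≤ V * (1 + lam) := mul_nonneg hV0.le (by linarith)
        linarith
  have hmain := card_prime_dvd_le hx hl1 hR1 hRl hl3 hQJ (by linarith) hE2
  refine hmain.trans ?_
  have hJle : (J : ℝ) ≤ lam / (64 * Real.log 2) + 1 := (Nat.ceil_lt_add_one (by positivity)).le
  have hlam0 : 0 < lam := by linarith
  have hl0 : (0 : ℝ) < l := by linarith
  have g1 : (l : ℝ) / Real.log (R + 1) ≤ 10 * (l / lam) := by
    calc (l : ℝ) / Real.log (R + 1) ≤ l / (lam / 10) := by gcongr
      _ = _ := by field_simp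
  have g2 : (R : ℝ) ^ 2 * (1 + 2 * E) ≤ 1 / 10 * (l / lam) := by
    have e1 : (R : ℝ) ^ 2 * (1 + 2 * E) ≤ 3 * (n : ℝ) ^ (77 / 160 : ℝ) := by
      calc (R : ℝ) ^ 2 * (1 + 2 * E) ≤ (n : ℝ) ^ (1 / 5 : ℝ) * (3 * E) := by
            gcongr; linarith
        _ = 3 * ((n : ℝ) ^ (1 / 5 : ℝ) * E) := by ring
        _ = _ := by rw [hE, ← Real.rpow_add hn0]; norm_num
    have e2 := f5.trans hl_low
    rw [mul_div_assoc', le_div_iff₀ hlam0]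
    have hV := hpow (77 / 160)
    calc (R : ℝ) ^ 2 * (1 + 2 * E) * lam ≤ 3 * (n : ℝ) ^ (77 / 160 : ℝ) * lam := by gcongr
      _ ≤ 1 / 10 * (30 * (n : ℝ) ^ (77 / 160 : ℝ) * (1 + lam)) := by linarith
      _ ≤ 1 / 10 * l := by linarith
  exact dyadic_total_le hl0.le hlog hJle g1 g2
    (div_nonneg hl0.le (Real.log_nonneg (by linarith [(Nat.cast_nonneg R : (0 : ℝ) ≤ R)])))
    (by positivity)

/-- The bound on `g₁`: the main terms of the lower and the upper bound for `∑ log (p / l)` over the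
primes `p > l` dividing `(n + 1) ⋯ (n + l)` are `2/5 * 1/64 * l log n` and `1/195 * l log n`. -/
theorem eventually_g₁_lt : ∀ᶠ n : ℕ in atTop, (g₁ n : ℝ) < (n : ℝ) ^ (97 / 195 : ℝ) := by
  have h2 := tendsto_natCast_atTop_atTop (R := ℝ)
  have hceil : Tendsto (fun n : ℕ => ⌈(n : ℝ) ^ (97 / 195 : ℝ)⌉₊) atTop atTop :=
    tendsto_nat_ceil_atTop.comp ((tendsto_rpow_atTop (by norm_num)).comp h2)
  filter_upwards [h2.eventually (Real.tendsto_log_atTop.eventually_ge_atTop 10000),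
    eventually_ge_atTop 2, eventually_card_prime_dvd_le,
    eventually_mul_rpow_mul_log_le 2 (show (97 / 195 : ℝ) < 1 by norm_num),
    hceil.eventually (eventually_primeCounting_le_mul (show (0 : ℝ) < 1 / 2000 by norm_num))]
    with n hlog hn2 hcount f1 hpi
  by_contra! hcon
  set lam := Real.log n with hlam
  have hn1 : (1 : ℝ) ≤ n := by exact_mod_cast (by omega : 1 ≤ n)
  have hn0 : (0 : ℝ) < n := by linarith
  set l := ⌈(n : ℝ) ^ (97 / 195 : ℝ)⌉₊ with hl
  have hγ1 : 1 ≤ (n : ℝ) ^ (97 / 195 : ℝ) := Real.one_le_rpow hn1 (by norm_num)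
  have hl_low : (n : ℝ) ^ (97 / 195 : ℝ) ≤ l := Nat.le_ceil _
  have hl_up : (l : ℝ) ≤ 2 * (n : ℝ) ^ (97 / 195 : ℝ) := by
    have := Nat.ceil_lt_add_one (show 0 ≤ (n : ℝ) ^ (97 / 195 : ℝ) by linarith)
    linarith
  have hl1' : (1 : ℝ) ≤ l := hγ1.trans hl_low
  have hl1 : 1 ≤ l := by exact_mod_cast hl1'
  have hlg : l ≤ g₁ n := Nat.ceil_le.2 hcon
  have hω : l ≤ (∏ i ∈ Finset.Icc 1 l, (n + i)).primeFactors.card :=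
    (isGreatest_g₁ (by omega)).1.2 l hl1 hlg
  have hln : (l : ℝ) ≤ n := by
    refine hl_up.trans ((le_mul_of_one_le_right (by positivity) (by linarith)).trans f1) |>.trans ?_
    rw [Real.rpow_one]
  set J := ⌈lam / (64 * Real.log 2)⌉₊ with hJ
  have hlog2 : 0 < Real.log 2 := Real.log_pos (by norm_num)
  have hK : Real.log l + lam / 64 ≤ Real.log ((2 ^ J * l : ℕ) : ℝ) := by
    have h1 := Nat.le_ceil (lam / (64 * Real.log 2))
    rw [← hJ, div_le_iff₀ (by positivity)] at h1
    push_cast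
    rw [Real.log_mul (by positivity) (by positivity), Real.log_pow]
    linarith
  have hmain := log_count_le_of_le_card_primeFactors hl1 (by linarith : 0 ≤ lam / 64) hω hK
    (Nat.mul_pos (by positivity) hl1) (hcount l hl_low hl_up)
  have hlogl : 97 / 195 * lam ≤ Real.log l := by
    have := Real.log_le_log (by linarith) hl_low
    rwa [Real.log_rpow hn0] at this
  have hlognl : Real.log (n + l) ≤ lam + 1 := by
    have h1 : Real.log (n + l) ≤ Real.log (2 * n) := Real.log_le_log (by linarith) (by linarith)
    rw [Real.log_mul (by norm_num) (by linarith)] at h1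
    have := Real.log_two_lt_d9
    linarith
  have hl0 : (0 : ℝ) < l := by linarith
  have hlogl0 : 0 ≤ Real.log l := by linarith
  have h1 : (l : ℝ) * ((1 - 1 / 2000) * Real.log l + (2 / 5 - 1 / 2000) * (lam / 64)) ≤
      l * (lam + 2 - Real.log l) := by
    calc _ = (l - 1 / 2000 * l) * Real.log l + (l - 1 / 2000 * l - 3 / 5 * l) * (lam / 64) := by
          ring
      _ ≤ (l - Nat.primeCounting l) * Real.log l +
          (l - Nat.primeCounting l - 3 / 5 * l) * (lam / 64) := by gcongr
      _ ≤ _ := hmain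
      _ ≤ _ := by gcongr; linarith
  -- With `log l ≥ 97/195 * log n` this contradicts
  -- `(2 - 1/2000) * 97/195 + (2/5 - 1/2000) / 64 > 1.0006`.
  have h3 := le_of_mul_le_mul_left h1 hl0
  linarith

end Grimm

theorem mainTheorem2 :
    (∃ γ : ℝ, 0 < γ ∧ γ < 1 / 2 ∧
      ∀ᶠ n : ℕ in atTop, Grimm.g n ≤ Grimm.g₁ n ∧ (Grimm.g₁ n : ℝ) < (n : ℝ) ^ γ) ∧
    (∀ᶠ n : ℕ in atTop,
      Grimm.g n ≤ Grimm.g₁ n ∧ (Grimm.g₁ n : ℝ) < (n : ℝ) ^ ((1 : ℝ) / 2 - 1 / 390)) ∧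
    (∃ c : ℝ, 0 < c ∧ ∀ᶠ n : ℕ in atTop, (Grimm.g n : ℝ) < (n : ℝ) ^ ((1 : ℝ) / 2 - c)) := by
  have h : ∀ᶠ n : ℕ in atTop,
      Grimm.g n ≤ Grimm.g₁ n ∧ (Grimm.g₁ n : ℝ) < (n : ℝ) ^ ((1 : ℝ) / 2 - 1 / 390) := by
    filter_upwards [Grimm.eventually_g₁_lt, eventually_ge_atTop 1] with n hn hn1
    refine ⟨(Grimm.isGreatest_g₁ hn1).2 (Grimm.gSet_subset_g₁Set n (Grimm.isGreatest_g hn1).1), ?_⟩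
    rwa [show (1 : ℝ) / 2 - 1 / 390 = 97 / 195 by norm_num]
  refine ⟨⟨1 / 2 - 1 / 390, by norm_num, by norm_num, h⟩, h, 1 / 390, by norm_num, ?_⟩
  filter_upwards [h] with n hn
  exact lt_of_le_of_lt (Nat.cast_le.2 hn.1) hn.2
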